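/- Let $K$ be a nonarchimedean local field with ring of integers $\mathcal O_K$, and let $\mathfrak A$ be a (finite-dimensional) central simple $K$-algebra with reduced norm $N:\mathfrak A^*\to K^*$, endowed with a metric $d$ inducing its topology as a finite-dimensional $K$-vector space (for example, the metric of a $K$-vector space norm). An order in $\mathfrak A$ is a subring containing $1$ that is a finitely generated $\mathcal O_K$-submodule (not necessarily spanning $\mathfrak A$). For subsets $S,T\subseteq\mathfrak A$ put $\rho(S,T)=\sup_{s\in S}d(s,T)$, and for orders $\mathfrak D,\mathfrak H$ in $\mathfrak A$ put $$H(\mathfrak D|\mathfrak H)=\{N(u) : u\in\mathfrak A^*,\ u^{-1}\mathfrak H u\subseteq\mathfrak D\},\qquad H(\mathfrak H)=H(\mathfrak H|\mathfrak H).$$ Let $L$ be a maximal subfield of $\mathfrak A$, i.e. a $K$-subalgebra that is a field and is maximal for inclusion among such, and let $\mathfrak H$ be an order of maximal rank in $L$, i.e. an order contained in $L$ with $K\mathfrak H=L$. Then there exists $\epsilon=\epsilon(\mathfrak H)>0$ such that, for every order $\mathfrak D$ in $\mathfrak A$ with $\mathfrak H\subseteq\mathfrak D$ and $\rho(\mathfrak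 D,\mathfrak H)\le\epsilon$, $$H(\mathfrak D|\mathfrak H)=H(\mathfrak H).$$ -/

import Mathlib

section ReducedNorm

open scoped TensorProduct

variable (K A : Type*) [Field K] [Ring A] [Algebra K A]

theorem CentralSimple.exists_of_mem_center_tensor [Algebra.IsCentral K A]
    (E : Type*) [Field E] [Algebra K E] (x : E ⊗[K] A)
    (h : ∀ a : A, (1 : E) ⊗ₜ[K] a * x = x * (1 : E) ⊗ₜ[K] a) :
    ∃ e : E, x = e ⊗ₜ[K] (1 : A) := by
  classical
  let b := Module.Basis.ofVectorSpace K E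
  let c := TensorProduct.equivFinsuppOfBasisLeft (N := A) b
  have hl : ∀ (a : A) (y : E ⊗[K] A) i, c ((1 : E) ⊗ₜ[K] a * y) i = a * c y i := by
    intro a y i
    induction y with
    | zero => simp
    | tmul e d => simp [c]
    | add y z hy hz => simp [mul_add, hy, hz]
  have hr : ∀ (a : A) (y : E ⊗[K] A) i, c (y * (1 : E) ⊗ₜ[K] a) i = c y i * a := by
    intro a y i
    induction y with
    | zero => simp
    | tmul e d => simp [c]
    | add y z hy hz => simp [add_mul, hy, hz]
  have hc : ∀ i, ∃ k : K, c x i = algebraMap K A k := fun i => by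
    rw [← Algebra.IsCentral.mem_center_iff]
    rw [Subalgebra.mem_center_iff]
    intro a
    rw [← hl, ← hr, h]
  choose k hk using hc
  have hx : x = c.symm (c x) := by simp
  rw [TensorProduct.equivFinsuppOfBasisLeft_symm_apply] at hx
  refine ⟨∑ i ∈ (c x).support, k i • b i, ?_⟩
  rw [TensorProduct.sum_tmul]
  conv_lhs => rw [hx]
  refine Finset.sum_congr rfl fun i _ => ?_
  rw [hk, Algebra.algebraMap_eq_smul_one]
  simp only [TensorProduct.tmul_smul, TensorProduct.smul_tmul']

theorem CentralSimple.isCentral_baseChange [Algebra.IsCentral K A]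
    (E : Type*) [Field E] [Algebra K E] : Algebra.IsCentral E (E ⊗[K] A) where
  out x hx := by
    obtain ⟨e, rfl⟩ := CentralSimple.exists_of_mem_center_tensor K A E x
      (fun a => (Subalgebra.mem_center_iff.1 hx) _)
    exact ⟨e, by simp [Algebra.TensorProduct.algebraMap_apply]⟩

theorem CentralSimple.isSimpleRing_baseChange [Algebra.IsCentral K A] [IsSimpleRing A]
    (E : Type*) [Field E] [Algebra K E] : IsSimpleRing (E ⊗[K] A) := by
  classical
  have : Nontrivial (E ⊗[K] A) := inferInstance
  refine IsSimpleRing.of_eq_bot_or_eq_top fun I => or_iff_not_imp_left.2 fun hI => ?_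
  let b := Module.Basis.ofVectorSpace K E
  let c := TensorProduct.equivFinsuppOfBasisLeft (N := A) b
  have hl : ∀ (a : A) (y : E ⊗[K] A) i, c ((1 : E) ⊗ₜ[K] a * y) i = a * c y i := by
    intro a y i
    induction y with
    | zero => simp
    | tmul e d => simp [c]
    | add y z hy hz => simp [mul_add, hy, hz]
  have hr : ∀ (a : A) (y : E ⊗[K] A) i, c (y * (1 : E) ⊗ₜ[K] a) i = c y i * a := by
    intro a y i
    induction y with
    | zero => simp
    | tmul e d => simp [c]
    | add y z hy hz => simp [add_mul, hy, hz]
  have hex : ∃ n, ∃ x ∈ I, x ≠ 0 ∧ (c x).support.card = n := by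
    obtain ⟨x, hx, hx0⟩ := SetLike.exists_of_lt (bot_lt_iff_ne_bot.2 hI)
    exact ⟨_, x, hx, fun h => hx0 (by simp [h]), rfl⟩
  obtain ⟨x, hxI, hx0, hxn⟩ := Nat.find_spec hex
  have hmin : ∀ y ∈ I, (c y).support.card < (c x).support.card → y = 0 := by
    intro y hy hlt
    by_contra h0
    exact Nat.find_min hex (hxn ▸ hlt) ⟨y, hy, h0, rfl⟩
  obtain ⟨i, hi⟩ : ∃ i, c x i ≠ 0 := by
    by_contra! h
    exact hx0 (c.injective (by ext i; simp [h]))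
  let J : TwoSidedIdeal A := TwoSidedIdeal.mk'
    {a | ∃ y ∈ I, (c y).support ⊆ (c x).support ∧ c y i = a}
    ⟨0, I.zero_mem, by simp, by simp⟩
    (by
      rintro _ _ ⟨y, hy, hs, rfl⟩ ⟨z, hz, ht, rfl⟩
      exact ⟨y + z, I.add_mem hy hz, by
        rw [map_add]
        exact Finsupp.support_add.trans (Finset.union_subset hs ht), by simp⟩)
    (by
      rintro _ ⟨y, hy, hs, rfl⟩
      exact ⟨-y, I.neg_mem hy, by simpa using hs, by simp⟩)
    (by
      rintro a _ ⟨y, hy, hs, rfl⟩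
      refine ⟨(1 : E) ⊗ₜ[K] a * y, I.mul_mem_left _ _ hy, fun j hj => hs ?_, hl _ _ _⟩
      rw [Finsupp.mem_support_iff, hl] at hj
      exact Finsupp.mem_support_iff.2 (right_ne_zero_of_mul hj))
    (by
      rintro _ a ⟨y, hy, hs, rfl⟩
      refine ⟨y * (1 : E) ⊗ₜ[K] a, I.mul_mem_right _ _ hy, fun j hj => hs ?_, hr _ _ _⟩
      rw [Finsupp.mem_support_iff, hr] at hj
      exact Finsupp.mem_support_iff.2 (left_ne_zero_of_mul hj))
  have hJ : ∀ a, a ∈ J ↔ ∃ y ∈ I, (c y).support ⊆ (c x).support ∧ c y i = a := fun a => by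
    simp [J]
  obtain ⟨y, hy, hys, hy1⟩ := (hJ 1).1
    (IsSimpleRing.one_mem_of_ne_zero_mem J hi ((hJ _).2 ⟨x, hxI, subset_rfl, rfl⟩))
  have hcomm : ∀ a : A, (1 : E) ⊗ₜ[K] a * y = y * (1 : E) ⊗ₜ[K] a := by
    intro a
    rw [← sub_eq_zero]
    refine hmin _ (I.sub_mem (I.mul_mem_left _ _ hy) (I.mul_mem_right _ _ hy)) ?_
    refine Finset.card_lt_card ((Finset.ssubset_iff_of_subset ?_).2
      ⟨i, Finsupp.mem_support_iff.2 hi, ?_⟩)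
    · intro j hj
      rw [Finsupp.mem_support_iff, map_sub, Finsupp.sub_apply, hl, hr] at hj
      refine hys (Finsupp.mem_support_iff.2 fun h => hj ?_)
      simp [h]
    · rw [Finsupp.notMem_support_iff, map_sub, Finsupp.sub_apply, hl, hr, hy1]
      simp
  obtain ⟨e, rfl⟩ := CentralSimple.exists_of_mem_center_tensor K A E y hcomm
  have he : e ≠ 0 := by
    rintro rfl
    simp at hy1
  rw [← TwoSidedIdeal.one_mem_iff]
  have := I.mul_mem_left (e⁻¹ ⊗ₜ[K] (1 : A)) _ hy
  simpa [he, Algebra.TensorProduct.one_def] using this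

theorem IsSepClosed.algebraMap_bijective_of_isCentral (E D : Type*) [Field E] [IsSepClosed E]
    [DivisionRing D] [Algebra E D] [Algebra.IsCentral E D] [FiniteDimensional E D] :
    Function.Bijective (algebraMap E D) := by
  refine ⟨(algebraMap E D).injective, ?_⟩
  have : (⊥ : Subalgebra E D) = ⊤ := by
    by_contra hne
    obtain ⟨x, hx, hs⟩ := JacobsonNoether.exists_separable_and_not_isCentral' hne
    apply hx
    have hint : IsIntegral E x := Algebra.IsIntegral.isIntegral x
    have h1 := IsSepClosed.degree_eq_one_of_irreducible E (minpoly.irreducible hint) hs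
    have := minpoly.mem_range_of_degree_eq_one E x h1
    exact this
  intro x
  exact (this ▸ Algebra.mem_top : x ∈ (⊥ : Subalgebra E D))

/-- The degree of a central simple algebra: the square root of its dimension. -/
noncomputable def CentralSimple.degree : ℕ := Nat.sqrt (Module.finrank K A)

theorem CentralSimple.exists_matrix_equiv [Algebra.IsCentral K A] [IsSimpleRing A] [FiniteDimensional K A]
    (E : Type*) [Field E] [Algebra K E] [IsSepClosed E] :
    CentralSimple.degree K A ^ 2 = Module.finrank K A ∧
      Nonempty (E ⊗[K] A ≃ₐ[E] Matrix (Fin (CentralSimple.degree K A)) (Fin (CentralSimple.degree K A)) E) := by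
  have := CentralSimple.isCentral_baseChange K A E
  have := CentralSimple.isSimpleRing_baseChange K A E
  have := IsArtinianRing.of_finite E (E ⊗[K] A)
  obtain ⟨n, hn, D, _, _, _, ⟨e⟩⟩ :=
    IsSimpleRing.exists_algEquiv_matrix_divisionRing_finite E (E ⊗[K] A)
  have hM : Algebra.IsCentral E (Matrix (Fin n) (Fin n) D) := Algebra.IsCentral.of_algEquiv E _ _ e
  have hD : Algebra.IsCentral E D := ⟨fun d hd => by
    have hd' : Matrix.scalarAlgHom (Fin n) E d ∈ Subalgebra.center E (Matrix (Fin n) (Fin n) D) := by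
      rw [Matrix.subalgebraCenter_eq_scalarAlgHom_map]
      exact ⟨d, hd, rfl⟩
    obtain ⟨k, hk⟩ := Algebra.IsCentral.mem_center_iff E |>.1 hd'
    have := congrFun (congrFun hk 0) 0
    simp only [Matrix.scalarAlgHom_apply, Matrix.scalar_apply, Matrix.diagonal_apply_eq,
      Matrix.algebraMap_matrix_apply, if_true] at this
    exact ⟨k, this.symm⟩⟩
  have e' : E ⊗[K] A ≃ₐ[E] Matrix (Fin n) (Fin n) E := e.trans <| .mapMatrix <| .symm <|
    .ofBijective (Algebra.ofId E D) (IsSepClosed.algebraMap_bijective_of_isCentral E D)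
  have hdim : n ^ 2 = Module.finrank K A := by
    have := e'.toLinearEquiv.finrank_eq
    rw [Module.finrank_baseChange, Module.finrank_matrix] at this
    simp only [Fintype.card_fin, Module.finrank_self, mul_one] at this
    rw [this, sq]
  have hdeg : CentralSimple.degree K A = n := by rw [CentralSimple.degree, ← hdim, Nat.sqrt_eq']
  rw [hdeg]
  exact ⟨hdim, ⟨e'⟩⟩

theorem CentralSimple.det_eq_det [Algebra.IsCentral K A] [IsSimpleRing A] [FiniteDimensional K A]
    (E : Type*) [Field E] [Algebra K E] {n : ℕ} (hn : n ^ 2 = Module.finrank K A)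
    (φ ψ : A →ₐ[K] Matrix (Fin n) (Fin n) E) (a : A) : (φ a).det = (ψ a).det := by
  have := CentralSimple.isSimpleRing_baseChange K A E
  have hpos : 0 < Module.finrank K A := Module.finrank_pos
  have : NeZero n := ⟨by rintro rfl; simp at hn; omega⟩
  have key : ∀ f : A →ₐ[K] Matrix (Fin n) (Fin n) E, ∃ F : E ⊗[K] A ≃ₐ[E] Matrix (Fin n) (Fin n) E,
      ∀ a, F (1 ⊗ₜ a) = f a := by
    intro f
    let g : E ⊗[K] A →ₐ[E] Matrix (Fin n) (Fin n) E :=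
      Algebra.TensorProduct.lift (Algebra.ofId E _) f fun x y => Algebra.commutes _ _
    have hinj : Function.Injective g := RingHom.injective g.toRingHom
    have hdim : Module.finrank E (E ⊗[K] A) = Module.finrank E (Matrix (Fin n) (Fin n) E) := by
      rw [Module.finrank_baseChange, Module.finrank_matrix, ← hn]
      simp [sq]
    have hsurj : Function.Surjective g :=
      (LinearMap.injective_iff_surjective_of_finrank_eq_finrank (f := g.toLinearMap) hdim).1 hinj
    exact ⟨AlgEquiv.ofBijective g ⟨hinj, hsurj⟩, fun a => by
      change g (1 ⊗ₜ a) = f a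
      rw [show g (1 ⊗ₜ a) = Algebra.ofId E (Matrix (Fin n) (Fin n) E) 1 * f a from
        Algebra.TensorProduct.lift_tmul _ _ _ _ _, map_one, one_mul]⟩
  obtain ⟨F, hF⟩ := key φ
  obtain ⟨G, hG⟩ := key ψ
  let u := (Matrix.toLinAlgEquiv' (R := E) (n := Fin n)).symm.trans
    ((F.symm.trans G).trans (Matrix.toLinAlgEquiv' (R := E) (n := Fin n)))
  obtain ⟨T, hT⟩ := AlgEquiv.eq_linearEquivConjAlgEquiv u
  have h1 : Matrix.toLinAlgEquiv' (ψ a) = T.conj (Matrix.toLinAlgEquiv' (φ a)) := by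
    have := congrArg (fun v => v (Matrix.toLinAlgEquiv' (φ a))) hT
    simp only [u, AlgEquiv.trans_apply, AlgEquiv.symm_apply_apply] at this
    rw [← hF a, AlgEquiv.symm_apply_apply, hG, hF] at this
    exact this
  have h2 := congrArg LinearMap.det h1
  rw [LinearEquiv.conj_apply, LinearMap.comp_assoc, LinearMap.det_conj] at h2
  have h3 : ∀ M : Matrix (Fin n) (Fin n) E,
      LinearMap.det (Matrix.toLinAlgEquiv' M : (Fin n → E) →ₗ[E] (Fin n → E)) = M.det :=
    fun M => LinearMap.det_toLin' M
  rw [h3, h3] at h2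
  exact h2.symm

theorem CentralSimple.exists_splitting [Algebra.IsCentral K A] [IsSimpleRing A] [FiniteDimensional K A]
    (E : Type*) [Field E] [Algebra K E] [IsSepClosed E] :
    Nonempty (A →ₐ[K] Matrix (Fin (CentralSimple.degree K A)) (Fin (CentralSimple.degree K A)) E) := by
  obtain ⟨-, ⟨e⟩⟩ := CentralSimple.exists_matrix_equiv K A E
  exact ⟨(e.toAlgHom.restrictScalars K).comp Algebra.TensorProduct.includeRight⟩

variable [Algebra.IsCentral K A] [IsSimpleRing A] [FiniteDimensional K A]

theorem CentralSimple.degree_sq : CentralSimple.degree K A ^ 2 = Module.finrank K A :=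
  (CentralSimple.exists_matrix_equiv K A (SeparableClosure K)).1

/-- The determinant of an element in a split representation over the separable closure lies in the
base field and does not depend on the representation. -/
theorem CentralSimple.exists_reducedNorm (a : A) : ∃ c : K,
    ∀ φ : A →ₐ[K] Matrix (Fin (CentralSimple.degree K A)) (Fin (CentralSimple.degree K A)) (SeparableClosure K),
      (φ a).det = algebraMap K (SeparableClosure K) c := by
  obtain ⟨ψ⟩ := CentralSimple.exists_splitting K A (SeparableClosure K)
  obtain ⟨c, hc⟩ : (ψ a).det ∈ Set.range (algebraMap K (SeparableClosure K)) := by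
    rw [InfiniteGalois.mem_range_algebraMap_iff_fixed]
    intro σ
    have := CentralSimple.det_eq_det K A _ (CentralSimple.degree_sq K A) (σ.toAlgHom.mapMatrix.comp ψ) ψ a
    exact (AlgHom.map_det σ.toAlgHom (ψ a)).trans this
  exact ⟨c, fun φ => by rw [hc, CentralSimple.det_eq_det K A _ (CentralSimple.degree_sq K A) φ ψ a]⟩

/-- The reduced norm `A → K` of a central simple algebra `A` of degree `n` over `K`: the value at
`a` is the determinant of `φ a`, for every `K`-algebra homomorphism `φ` from `A` to the
`n × n` matrices over the separable closure of `K`. -/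
noncomputable def reducedNorm : A →* K where
  toFun a := (CentralSimple.exists_reducedNorm K A a).choose
  map_one' := by
    obtain ⟨ψ⟩ := CentralSimple.exists_splitting K A (SeparableClosure K)
    apply (algebraMap K (SeparableClosure K)).injective
    rw [← (CentralSimple.exists_reducedNorm K A 1).choose_spec ψ]
    simp
  map_mul' a b := by
    obtain ⟨ψ⟩ := CentralSimple.exists_splitting K A (SeparableClosure K)
    apply (algebraMap K (SeparableClosure K)).injective
    rw [map_mul, ← (CentralSimple.exists_reducedNorm K A _).choose_spec ψ,
      ← (CentralSimple.exists_reducedNorm K A _).choose_spec ψ,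
      ← (CentralSimple.exists_reducedNorm K A _).choose_spec ψ, map_mul, Matrix.det_mul]

/-- The reduced norm can be computed in any split representation, over any field extension. -/
theorem algebraMap_reducedNorm (a : A) {F : Type*} [Field F] [Algebra K F]
    (φ : A →ₐ[K] Matrix (Fin (CentralSimple.degree K A)) (Fin (CentralSimple.degree K A)) F) :
    algebraMap K F (reducedNorm K A a) = (φ a).det := by
  obtain ⟨ψ⟩ := CentralSimple.exists_splitting K A (SeparableClosure K)
  have hc : algebraMap K (SeparableClosure K) (reducedNorm K A a) = (ψ a).det :=
    ((CentralSimple.exists_reducedNorm K A a).choose_spec ψ).symm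
  let i : SeparableClosure K →ₐ[K] AlgebraicClosure F := IsSepClosed.lift
  let j : F →ₐ[K] AlgebraicClosure F := IsScalarTower.toAlgHom K F _
  have h1 : j ((φ a).det) = i ((ψ a).det) := by
    rw [AlgHom.map_det, AlgHom.map_det]
    exact CentralSimple.det_eq_det K A _ (CentralSimple.degree_sq K A) (j.mapMatrix.comp φ) (i.mapMatrix.comp ψ) a
  have h2 : j (algebraMap K F (reducedNorm K A a)) = j ((φ a).det) := by
    rw [h1, ← hc, AlgHom.commutes, AlgHom.commutes]
  exact RingHom.injective j.toRingHom h2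

end ReducedNorm

section Orders

open ValuativeRel

variable {K A : Type*} [Field K] [ValuativeRel K] [Ring A] [Algebra K A]

/-- An order in the `K`-algebra `A`: a subring containing `1` that is a finitely generated
`𝒪[K]`-submodule. It need not span `A` over `K`. -/
def IsOrder (D : Subalgebra 𝒪[K] A) : Prop :=
  (Subalgebra.toSubmodule D).FG

/-- `H` is an order of maximal rank in the subalgebra `L`: an order contained in `L`
that spans `L` over `K`. -/
def IsOrderOfMaximalRankIn (H : Subalgebra 𝒪[K] A) (L : Subalgebra K A) : Prop :=
  IsOrder H ∧ Submodule.span K (H : Set A) = Subalgebra.toSubmodule L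

/-- `L` is a maximal subfield of the `K`-algebra `A`, that is, maximal for inclusion among the
`K`-subalgebras of `A` that are fields. -/
def IsMaximalSubfield (L : Subalgebra K A) : Prop :=
  Maximal (fun M : Subalgebra K A => IsField M) L

/-- The one-sided Hausdorff distance `ρ(S, T) = sup_{s ∈ S} d(s, T)`. -/
noncomputable def oneSidedHausdorffEDist {X : Type*} [PseudoEMetricSpace X] (S T : Set X) :
    ENNReal :=
  ⨆ s ∈ S, Metric.infEDist s T

/-- The set `H(D|H)` of reduced norms of the units `u` of `A` with `u⁻¹ H u ⊆ D`. -/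
def orderNormSet [Algebra.IsCentral K A] [IsSimpleRing A] [FiniteDimensional K A]
    (D H : Subalgebra 𝒪[K] A) : Set Kˣ :=
  {c | ∃ u : Aˣ, (∀ h ∈ H, (↑u⁻¹ : A) * h * (u : A) ∈ D) ∧ c = Units.map (reducedNorm K A) u}

end Orders

open ValuativeRel

/-! ### Endomorphisms of modules over simple artinian algebras -/

section SimpleRingModule

universe u
variable {E : Type u} [Field E]

/-! Let `E` be the maximal subfield, acting on `A` by left multiplication, and attach to a unit u
the embedding ψ(z) = u⁻¹zu of `E` in `A`. If u⁻¹Hu ⊆ D and D is close to H, then ψ nearly maps H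
into H. The embeddings that map H into a compact thickening of H form a compact set for pointwise
convergence, because H spans `E`. As the thickening shrinks, these sets decrease to the set of
automorphisms σ of `E` that map H into H. By compactness it suffices to treat embeddings ψ near one
such σ (`exists_orderNormSet_eq`).

There rigidity holds. A Casimir element Σ xᵢ ⊗ yᵢ of `E` gives t = Σ σ(xᵢ) a ψ(yᵢ) with σ(z)t =
tψ(z), where a is chosen so that t = 1 at ψ = σ (`exists_intertwiner`). For ψ near σ, the reduced
norm of t is near 1, so t is invertible and N(t) = N(l) for some nonzero l in `E`. Then w = l u t⁻¹
has the reduced norm of u and induces σ, so it conjugates H into H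
(`eventually_exists_unit_of_conj`).

Two facts support this. First, `E` is its own centralizer and its degree is that of `A`
(`exists_eq_smul_one_of_commute`, `finrank_eq_degree`). The centralizer is a matrix algebra over a
division algebra over `E`. Since `E` has extensions of every prime degree, that algebra contains a
field larger than `E` unless it equals `E`. Second, reduced norms from `E` fill a neighbourhood of
1, even when `E` is inseparable over `K` (`eventually_exists_reducedNorm_smul_one_eq`). -/

theorem exists_field_extension_matrix (l k : ℕ) (hl : l.Prime) (hlk : l ∣ k) [NeZero k]
    (a : E) (ha : ∀ b : E, b ^ l ≠ a) (D : Type*) [Ring D] [Algebra E D] :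
    ∃ (F : Type u) (_ : Field F) (_ : Algebra E F) (_ : F →ₐ[E] Matrix (Fin k) (Fin k) D),
      Module.finrank E F = l := by
  classical
  have hirr := X_pow_sub_C_irreducible_of_prime hl ha
  have : Fact (Irreducible (Polynomial.X ^ l - Polynomial.C a)) := ⟨hirr⟩
  let F := AdjoinRoot (Polynomial.X ^ l - Polynomial.C a)
  have hne : (Polynomial.X ^ l - Polynomial.C a) ≠ 0 := hirr.ne_zero
  have hfin : Module.finrank E F = l := by
    rw [(AdjoinRoot.powerBasis hne).finrank, AdjoinRoot.powerBasis_dim,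
      Polynomial.natDegree_X_pow_sub_C]
  have : FiniteDimensional E F := (AdjoinRoot.powerBasis hne).finite
  obtain ⟨m, rfl⟩ := hlk
  -- The `E`-space F ^ m has dimension l * m, so `F` acts on it by matrices of exactly the required
  -- size.
  let b : Module.Basis (Fin (l * m)) E (Fin m → F) :=
    Module.finBasisOfFinrankEq E _ (by rw [Module.finrank_pi_fintype]; simp [hfin, mul_comm])
  exact ⟨F, inferInstance, inferInstance, ((Algebra.ofId E D).mapMatrix.comp
    (LinearMap.toMatrixAlgEquiv b).toAlgHom).comp (Algebra.lsmul E E (Fin m → F)), hfin⟩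

/-- A division algebra all of whose subfields are trivial is trivial. -/
theorem finrank_eq_one_of_subfields_eq_bot {D : Type*} [DivisionRing D]
    [Algebra E D] [FiniteDimensional E D]
    (hmax : ∀ M : Subalgebra E D, IsField M → M = ⊥) : Module.finrank E D = 1 := by
  rw [← Subalgebra.bot_eq_top_iff_finrank_eq_one]
  refine (eq_top_iff.2 fun d _ => ?_ : (⊥ : Subalgebra E D) = ⊤)
  have hcomm : ∀ x ∈ ({d} : Set D), ∀ y ∈ ({d} : Set D), x * y = y * x := by
    rintro x rfl y rfl; rfl
  have := Algebra.isMulCommutative_adjoin E hcomm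
  have hf : IsField (Algebra.adjoin E {d}) :=
    isField_of_isIntegral_of_isField' (R := E) (Field.toIsField E)
  exact hmax _ hf ▸ Algebra.subset_adjoin rfl

/-- A prime l dividing k would give a subfield of degree l. Hence k = 1, and the division algebra
`D` has only trivial subfields. -/
theorem finrank_eq_one_of_matrix {k : ℕ} [NeZero k] {D : Type*} [DivisionRing D]
    [Algebra E D] [FiniteDimensional E D]
    (hE : ∀ l : ℕ, l.Prime → ∃ a : E, ∀ b : E, b ^ l ≠ a)
    (hmax : ∀ M : Subalgebra E (Matrix (Fin k) (Fin k) D), IsField M → M = ⊥) :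
    Module.finrank E (Matrix (Fin k) (Fin k) D) = 1 := by
  have key : ∀ {F : Type _} [Field F] [Algebra E F] (f : F →ₐ[E] Matrix (Fin k) (Fin k) D),
      f.range = ⊥ := fun f => hmax _ <|
    (AlgEquiv.ofInjectiveField f).symm.toMulEquiv.isField (Field.toIsField _)
  have hk : k = 1 := by
    by_contra hk
    obtain ⟨a, ha⟩ := hE _ (Nat.minFac_prime hk)
    obtain ⟨F, _, _, f, hf⟩ :=
      exists_field_extension_matrix _ k (Nat.minFac_prime hk) (Nat.minFac_dvd k) a ha D
    have h1 : Module.finrank E f.range = 1 := by rw [key f, Subalgebra.finrank_bot]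
    rw [← (AlgEquiv.ofInjectiveField f).toLinearEquiv.finrank_eq, hf] at h1
    exact (Nat.minFac_prime hk).one_lt.ne' h1
  subst hk
  have e : Matrix (Fin 1) (Fin 1) D ≃ₐ[E] D :=
    { toFun := fun M => M 0 0
      invFun := fun d => Matrix.of fun _ _ => d
      left_inv := fun M => by ext i j; simp [Subsingleton.elim i 0, Subsingleton.elim j 0]
      right_inv := fun _ => rfl
      map_add' := fun _ _ => rfl
      map_mul' := fun M N => by simp [Matrix.mul_apply]
      commutes' := fun c => by simp [Matrix.algebraMap_matrix_apply] }
  rw [e.toLinearEquiv.finrank_eq]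
  refine finrank_eq_one_of_subfields_eq_bot fun M hM => ?_
  have h := hmax (M.map e.symm.toAlgHom)
    ((M.equivMapOfInjective e.symm.toAlgHom e.symm.injective).symm.toMulEquiv.isField hM)
  have h2 := congrArg (Subalgebra.map e.toAlgHom) h
  rwa [Subalgebra.map_map, Algebra.map_bot, show e.toAlgHom.comp e.symm.toAlgHom = AlgHom.id E D
    from AlgHom.ext fun x => e.apply_symm_apply x, Subalgebra.map_id] at h2

/-- The structure theorem used: over a simple artinian ring, the endomorphisms of a module form
a simple ring; if all its subfields are trivial, they are scalars. -/
theorem exists_end_eq_smul {R M : Type*} [Ring R] [Algebra E R] [IsSimpleRing R]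
    [IsArtinianRing R] [AddCommGroup M] [Module R M] [Module E M] [IsScalarTower E R M]
    [FiniteDimensional E M] [Nontrivial M]
    (hE : ∀ l : ℕ, l.Prime → ∃ a : E, ∀ b : E, b ^ l ≠ a)
    (hmax : ∀ S : Subalgebra E (Module.End R M), IsField S → S = ⊥) :
    ∀ f : Module.End R M, ∃ c : E, ∀ m, f m = c • m := by
  have : Module.Finite R M := Module.Finite.of_restrictScalars_finite E R M
  have : FiniteDimensional E (Module.End R M) := by
    let f : Module.End R M →ₗ[E] (M →ₗ[E] M) :=
      { toFun := fun g => g.restrictScalars E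
        map_add' := fun _ _ => rfl
        map_smul' := fun _ _ => rfl }
    exact Module.Finite.of_injective f fun g h hgh => LinearMap.ext fun x =>
      congrArg (fun k : M →ₗ[E] M => k x) hgh
  obtain ⟨n, hn, S, hS, ⟨e⟩⟩ := (IsSimpleRing.isIsotypic R M).linearEquiv_fun
  classical
  -- M is a power of one simple module S, so its endomorphism ring is a matrix ring over the
  -- division ring End S.
  have hs : IsSimpleRing (Module.End R M) :=
    IsSimpleRing.of_ringEquiv ((endVecRingEquivMatrixEnd (Fin n) R S).symm.trans
      e.symm.conjRingEquiv) inferInstance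
  have := IsArtinianRing.of_finite E (Module.End R M)
  obtain ⟨k, _, D, _, _, _, ⟨g⟩⟩ :=
    IsSimpleRing.exists_algEquiv_matrix_divisionRing_finite E (Module.End R M)
  have h1 : Module.finrank E (Module.End R M) = 1 := by
    rw [g.toLinearEquiv.finrank_eq]
    refine finrank_eq_one_of_matrix hE fun T hT => ?_
    have h := hmax (T.map g.symm.toAlgHom)
      ((T.equivMapOfInjective g.symm.toAlgHom g.symm.injective).symm.toMulEquiv.isField hT)
    have h2 := congrArg (Subalgebra.map g.toAlgHom) h
    rwa [Subalgebra.map_map, Algebra.map_bot, show g.toAlgHom.comp g.symm.toAlgHom = AlgHom.id E _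
      from AlgHom.ext fun x => g.apply_symm_apply x, Subalgebra.map_id] at h2
  intro f
  obtain ⟨c, hc⟩ := Algebra.mem_bot.1
    (Subalgebra.bot_eq_top_of_finrank_eq_one h1 ▸ Algebra.mem_top : f ∈ (⊥ : Subalgebra E _))
  exact ⟨c, fun m => by rw [← hc]; rfl⟩

/-- Density theorem: an `E`-linear map commutes with all `R`-endomorphisms, as these are scalars,
and `M` is semisimple over `R` and finite over its endomorphism ring. -/
theorem exists_smul_eq_of_end_eq_smul {R M : Type*} [Ring R] [Algebra E R] [IsSimpleRing R]
    [IsArtinianRing R] [AddCommGroup M] [Module R M] [Module E M] [IsScalarTower E R M]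
    [FiniteDimensional E M] (hsc : ∀ f : Module.End R M, ∃ c : E, ∀ m, f m = c • m)
    (f : M →ₗ[E] M) : ∃ r : R, ∀ m, f m = r • m := by
  have : Module.Finite (Module.End R M) M := by
    have : IsScalarTower E (Module.End R M) M := ⟨fun _ _ _ => rfl⟩
    exact Module.Finite.of_restrictScalars_finite E _ M
  let F : Module.End (Module.End R M) M :=
    { toFun := f
      map_add' := f.map_add
      map_smul' := fun g m => by
        obtain ⟨c, hc⟩ := hsc g
        simp [hc] }
  obtain ⟨r, hr⟩ := Module.Finite.toModuleEnd_moduleEnd_surjective F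
  exact ⟨r, fun m => congrArg (fun k : Module.End (Module.End R M) M => k m) hr.symm⟩

end SimpleRingModule

/-! ### Maximal subfields: centralizer and degree -/

section MaximalSubfield

open scoped TensorProduct

/-- A finite extension of a discretely valued field is not closed under `l`-th roots. -/
theorem exists_forall_pow_ne (K E : Type*) [Field K] [ValuativeRel K] [TopologicalSpace K]
    [IsNonarchimedeanLocalField K] [Field E] [Algebra K E] [FiniteDimensional K E]
    (l : ℕ) (hl : l.Prime) : ∃ a : E, ∀ b : E, b ^ l ≠ a := by
  by_contra! h
  obtain ⟨x, hx0, hx1⟩ := Valuation.IsNontrivial.exists_lt_one (v := valuation K)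
  have hx0' : x ≠ 0 := by rintro rfl; simp at hx0
  let e := IsNonarchimedeanLocalField.valueGroupWithZeroIsoInt K
  let w : E → ℤ := fun y => WithZero.log (e (valuation K (Algebra.norm K y)))
  have hw : ∀ (y : E) (m : ℕ), w (y ^ m) = m * w y := fun y m => by
    simp only [w, map_pow, WithZero.log_pow, nsmul_eq_mul]
  -- With roots of every order l ^ j, the nonzero integer w(x) would be divisible by every power of
  -- l.
  have hroot : ∀ j : ℕ, ∃ y : E, y ^ l ^ j = algebraMap K E x := fun j => by
    induction j with
    | zero => exact ⟨algebraMap K E x, by simp⟩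
    | succ j ih =>
      obtain ⟨y, hy⟩ := ih
      obtain ⟨z, hz⟩ := h y
      exact ⟨z, by rw [pow_succ', pow_mul, hz, hy]⟩
  have hwx : w (algebraMap K E x) ≠ 0 := by
    have h1 : w (algebraMap K E x) =
        Module.finrank K E * WithZero.log (e (valuation K x)) := by
      simp only [w, Algebra.norm_algebraMap, map_pow, WithZero.log_pow, nsmul_eq_mul]
    rw [h1]
    refine mul_ne_zero (by exact_mod_cast (Module.finrank_pos (R := K) (M := E)).ne') fun h0 => ?_
    have h2 : e (valuation K x) = 1 := by
      rw [← WithZero.exp_log (x := e (valuation K x)) (by simp [hx0']), h0, WithZero.exp_zero]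
    rw [map_eq_one_iff e e.injective] at h2
    exact hx1.ne h2
  have hdvd : ∀ j : ℕ, l ^ j ∣ (w (algebraMap K E x)).natAbs := fun j => by
    obtain ⟨y, hy⟩ := hroot j
    rw [← hy, hw, Int.natAbs_mul]
    exact Dvd.intro _ rfl
  have h3 := Nat.le_of_dvd (Int.natAbs_pos.2 hwx) (hdvd (w (algebraMap K E x)).natAbs)
  exact absurd h3 (Nat.lt_pow_self hl.one_lt).not_ge

instance MulOpposite.instIsCentral (K A : Type*) [Field K] [Ring A] [Algebra K A]
    [Algebra.IsCentral K A] : Algebra.IsCentral K Aᵐᵒᵖ where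
  out x hx := by
    obtain ⟨c, hc⟩ := Algebra.IsCentral.mem_center_iff K (x := x.unop) |>.1
      (Subalgebra.mem_center_iff.2 fun a =>
        MulOpposite.op_injective (by simpa using (Subalgebra.mem_center_iff.1 hx (.op a)).symm))
    exact ⟨c, MulOpposite.unop_injective (by simpa using hc.symm)⟩

variable {K A E R : Type*} [Field K] [Ring A] [Algebra K A] [Field E] [Algebra K E] [Module E A]
  [IsScalarTower K E A] [IsScalarTower E A A] [Ring R] [Algebra E R] [Module R A]
  [IsScalarTower E R A]

theorem end_apply_of_mul_right (hR : ∀ a : A, ∃ r : R, ∀ m : A, r • m = m * a)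
    (f : Module.End R A) (a : A) : f a = f 1 * a := by
  obtain ⟨r, hr⟩ := hR a
  rw [← hr, ← map_smul, hr, one_mul]

/-- Endomorphisms commuting with right multiplications are left multiplications. -/
def endEvalOne (hR : ∀ a : A, ∃ r : R, ∀ m : A, r • m = m * a) : Module.End R A →+* A where
  toFun f := f 1
  map_one' := rfl
  map_zero' := rfl
  map_add' _ _ := rfl
  map_mul' f g := end_apply_of_mul_right hR f (g 1)

theorem endEvalOne_injective (hR : ∀ a : A, ∃ r : R, ∀ m : A, r • m = m * a) :
    Function.Injective (endEvalOne hR) := fun f g h =>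
  LinearMap.ext fun a => by
    rw [end_apply_of_mul_right hR, end_apply_of_mul_right hR g]
    exact congrArg (· * a) h

variable (K A E) in
/-- `E`, acting on `A`, is maximal among the commutative subfields of `A`. -/
def ActsAsMaximalSubfield : Prop :=
  ∀ S : Subalgebra K A, IsField S → (∀ e : E, e • (1 : A) ∈ S) → ∀ s ∈ S, ∃ e : E, s = e • 1

variable [FiniteDimensional K A] [Nontrivial A]

-- Evaluation at 1 carries a subfield of the endomorphism algebra to a subfield of `A` containing
-- `E`, which maximality forces to be `E`.
omit [IsScalarTower E A A] in
theorem exists_end_eq_smul_of_actsAsMaximalSubfield [IsSimpleRing R] [IsArtinianRing R]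
    (hR : ∀ a : A, ∃ r : R, ∀ m : A, r • m = m * a)
    (hE : ∀ l : ℕ, l.Prime → ∃ a : E, ∀ b : E, b ^ l ≠ a)
    (hmax : ActsAsMaximalSubfield K A E) :
    ∀ f : Module.End R A, ∃ c : E, ∀ m, f m = c • m := by
  have : FiniteDimensional E A := Module.Finite.of_restrictScalars_finite K E A
  refine exists_end_eq_smul hE fun S hS => ?_
  have halg : ∀ e : E, endEvalOne hR (algebraMap E (Module.End R A) e) = e • 1 :=
    fun e => rfl
  let T : Subalgebra K A :=
    { S.toSubring.map (endEvalOne hR) with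
      algebraMap_mem' := fun k => ⟨algebraMap E _ (algebraMap K E k), S.algebraMap_mem _, by
        rw [halg, algebraMap_smul, Algebra.algebraMap_eq_smul_one]⟩ }
  have hT : IsField T :=
    (S.toSubring.equivMapOfInjective _ (endEvalOne_injective hR)).symm.toMulEquiv.isField hS
  refine (eq_bot_iff.2 fun f hf => ?_ : S = ⊥)
  obtain ⟨e, he⟩ := hmax T hT (fun e => ⟨algebraMap E _ e, S.algebraMap_mem _, halg e⟩)
    (endEvalOne hR f) ⟨f, hf, rfl⟩
  exact Algebra.mem_bot.2 ⟨e, endEvalOne_injective hR (by rw [he, halg])⟩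

/-- The `E`-`A`-bimodule structure on `A`, as a homomorphism from `E ⊗ Aᵐᵒᵖ`. -/
noncomputable def bimoduleHom (K A E : Type*) [Field K] [Ring A] [Algebra K A] [Field E]
    [Algebra K E] [Module E A] [IsScalarTower K E A] [IsScalarTower E A A] :
    E ⊗[K] Aᵐᵒᵖ →ₐ[E] Module.End E A :=
  have : SMulCommClass Aᵐᵒᵖ E A := SMulCommClass.symm _ _ _
  Algebra.TensorProduct.lift (Algebra.ofId E _) (Algebra.lsmul K E A)
    fun _ _ => Algebra.commutes _ _

omit [FiniteDimensional K A] [Nontrivial A] in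
theorem bimoduleHom_tmul (e : E) (b : Aᵐᵒᵖ) (m : A) :
    bimoduleHom K A E (e ⊗ₜ b) m = e • (m * b.unop) := by
  have : SMulCommClass Aᵐᵒᵖ E A := SMulCommClass.symm _ _ _
  exact congrArg (fun f : Module.End E A => f m)
    (Algebra.TensorProduct.lift_tmul (Algebra.ofId E (Module.End E A)) (Algebra.lsmul K E A)
      (fun _ _ => Algebra.commutes _ _) e b)

variable [Algebra.IsCentral K A] [IsSimpleRing A]

-- E ⊗ Aᵐᵒᵖ is simple, so it acts faithfully on `A`.
omit [FiniteDimensional K A] in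
theorem exists_sum_mul_ne_zero {ι : Type*} [Fintype ι] (x : ι → E) (y : ι → Aᵐᵒᵖ)
    (h : ∑ i, x i ⊗ₜ[K] y i ≠ 0) : ∃ a : A, ∑ i, x i • (a * (y i).unop) ≠ 0 := by
  have := CentralSimple.isSimpleRing_baseChange K Aᵐᵒᵖ E
  by_contra! h0
  refine h ((bimoduleHom K A E).toRingHom.injective ?_)
  ext a
  simpa [bimoduleHom_tmul] using h0 a

theorem exists_end_range_bimoduleHom_eq_smul (hE : ∀ l : ℕ, l.Prime → ∃ a : E, ∀ b : E, b ^ l ≠ a)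
    (hmax : ActsAsMaximalSubfield K A E) :
    IsSimpleRing (bimoduleHom K A E).range ∧ IsArtinianRing (bimoduleHom K A E).range ∧
    ∀ f : Module.End (bimoduleHom K A E).range A, ∃ c : E, ∀ m, f m = c • m := by
  have h1 := CentralSimple.isSimpleRing_baseChange K Aᵐᵒᵖ E
  have h2 := IsArtinianRing.of_finite E (E ⊗[K] Aᵐᵒᵖ)
  have h3 : IsSimpleRing (bimoduleHom K A E).range :=
    IsSimpleRing.of_surjective (bimoduleHom K A E).rangeRestrict.toRingHom h1
      (bimoduleHom K A E).rangeRestrict_surjective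
  have h4 : IsArtinianRing (bimoduleHom K A E).range :=
    (bimoduleHom K A E).rangeRestrict_surjective.isArtinianRing (f := (bimoduleHom K A E).rangeRestrict.toRingHom)
  refine ⟨h3, h4, exists_end_eq_smul_of_actsAsMaximalSubfield
    (R := (bimoduleHom K A E).range) (fun a =>
    ⟨⟨bimoduleHom K A E (1 ⊗ₜ .op a), _, rfl⟩, fun m => ?_⟩) hE hmax⟩
  exact (bimoduleHom_tmul 1 (.op a) m).trans (one_smul _ _)

/-- Left multiplication by c is an endomorphism of the `E`-`A`-bimodule `A`, hence a scalar from
`E`. -/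
theorem exists_eq_smul_one_of_commute (hE : ∀ l : ℕ, l.Prime → ∃ a : E, ∀ b : E, b ^ l ≠ a)
    (hmax : ActsAsMaximalSubfield K A E) (c : A) (hc : ∀ e : E, c * e • 1 = e • c) :
    ∃ e : E, c = e • 1 := by
  obtain ⟨-, -, h1⟩ := exists_end_range_bimoduleHom_eq_smul hE hmax
  let f : Module.End (bimoduleHom K A E).range A :=
    { toFun := fun a => c * a
      map_add' := mul_add c
      map_smul' := by
        rintro ⟨_, x, rfl⟩ a
        change c * bimoduleHom K A E x a = bimoduleHom K A E x (c * a)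
        induction x with
        | zero => simp
        | tmul e b =>
          rw [bimoduleHom_tmul, bimoduleHom_tmul, ← one_mul (a * b.unop), ← smul_mul_assoc,
            ← mul_assoc, hc, smul_mul_assoc, mul_assoc]
        | add x y hx hy => simp only [map_add, LinearMap.add_apply, mul_add, hx, hy] }
  obtain ⟨e, he⟩ := h1 f
  exact ⟨e, by simpa [f] using he 1⟩

/-- By double centralizer, E ⊗ Aᵐᵒᵖ is the full algebra of `E`-endomorphisms of `A`. Comparing
dimensions over `E` shows that dim A over `K` is the square of dim A over `E`. -/
theorem finrank_eq_degree (hE : ∀ l : ℕ, l.Prime → ∃ a : E, ∀ b : E, b ^ l ≠ a)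
    (hmax : ActsAsMaximalSubfield K A E) [FiniteDimensional K E] :
    Module.finrank E A = CentralSimple.degree K A ∧
      Module.finrank K E = CentralSimple.degree K A := by
  obtain ⟨_, _, h1⟩ := exists_end_range_bimoduleHom_eq_smul hE hmax
  have := CentralSimple.isSimpleRing_baseChange K Aᵐᵒᵖ E
  have : FiniteDimensional E A := Module.Finite.of_restrictScalars_finite K E A
  have hF : Function.Bijective (bimoduleHom K A E) := by
    refine ⟨(bimoduleHom K A E).toRingHom.injective, fun f => ?_⟩
    obtain ⟨⟨_, x, rfl⟩, hr⟩ := exists_smul_eq_of_end_eq_smul (R := (bimoduleHom K A E).range) h1 f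
    exact ⟨x, LinearMap.ext fun m => (hr m).symm⟩
  have h1 := (AlgEquiv.ofBijective _ hF).toLinearEquiv.finrank_eq
  rw [Module.finrank_baseChange, Module.finrank_linearMap,
    (MulOpposite.opLinearEquiv K : A ≃ₗ[K] Aᵐᵒᵖ).symm.finrank_eq, ← CentralSimple.degree_sq K A,
    sq] at h1
  have h2 := Module.finrank_mul_finrank K E A
  have h3 := Nat.mul_self_inj.1 h1
  rw [← CentralSimple.degree_sq K A, sq] at h2
  have hpos : 0 < Module.finrank E A := Module.finrank_pos
  rw [← h3] at hpos h2
  exact ⟨h3.symm, Nat.eq_of_mul_eq_mul_right hpos h2⟩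

end MaximalSubfield

/-! ### Reduced norms as determinants of right multiplications -/

section NormOnSubfield

theorem det_lsmul_eq_norm_pow {K E M : Type*} [Field K] [Field E] [Algebra K E] [AddCommGroup M]
    [Module K M] [Module E M] [IsScalarTower K E M] (x : E) :
    LinearMap.det ((LinearMap.lsmul E M x).restrictScalars K) =
      Algebra.norm K x ^ Module.finrank E M := by
  rw [LinearMap.det_restrictScalars, ← map_pow]
  congr 1
  have : LinearMap.lsmul E M x = x • LinearMap.id := by ext; simp
  rw [this, LinearMap.det_smul, LinearMap.det_id, mul_one]

variable {K A E : Type*} [Field K] [Ring A] [Algebra K A] [Field E] [Algebra K E] [Module E A]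
  [IsScalarTower K E A] [IsScalarTower E A A]

variable (K) in
/-- Right multiplications of `A`, as transposed matrices over `E`. -/
noncomputable def mulRightMatrix {n : ℕ} (b : Module.Basis (Fin n) E A) :
    A →ₐ[K] Matrix (Fin n) (Fin n) E where
  -- Right multiplication reverses products; the transpose restores their order.
  toFun a := (LinearMap.toMatrix b b (LinearMap.mulRight E a)).transpose
  map_one' := by rw [LinearMap.mulRight_one, LinearMap.toMatrix_id, Matrix.transpose_one]
  map_mul' x y := by
    rw [LinearMap.mulRight_mul, LinearMap.toMatrix_comp b b, Matrix.transpose_mul]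
  map_zero' := by ext; simp
  map_add' x y := by ext; simp [LinearMap.toMatrix_apply, mul_add]
  commutes' k := by
    ext i j
    rw [Matrix.transpose_apply, LinearMap.toMatrix_apply, LinearMap.mulRight_apply,
      ← Algebra.commutes, ← Algebra.smul_def, ← algebraMap_smul E k, map_smul, b.repr_self,
      Finsupp.smul_apply, Finsupp.single_apply, Matrix.algebraMap_matrix_apply]
    simp

theorem det_mulRightMatrix {n : ℕ} (b : Module.Basis (Fin n) E A) (a : A) :
    (mulRightMatrix K b a).det = LinearMap.det (LinearMap.mulRight E a) :=
  (Matrix.det_transpose _).trans (LinearMap.det_toMatrix b _)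

variable [Algebra.IsCentral K A] [IsSimpleRing A] [FiniteDimensional K A]

theorem algebraMap_reducedNorm_eq_det_mulRight (h1 : Module.finrank E A = CentralSimple.degree K A)
    (a : A) : algebraMap K E (reducedNorm K A a) = LinearMap.det (LinearMap.mulRight E a) := by
  have : FiniteDimensional E A := Module.Finite.of_restrictScalars_finite K E A
  rw [algebraMap_reducedNorm K A a (mulRightMatrix K (Module.finBasisOfFinrankEq E A h1)),
    det_mulRightMatrix]

theorem reducedNorm_pow_finrank [FiniteDimensional K E] (h1 : Module.finrank E A = CentralSimple.degree K A) (a : A) :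
    reducedNorm K A a ^ Module.finrank K E = LinearMap.det (LinearMap.mulRight K a) := by
  rw [← Algebra.norm_algebraMap (S := E), algebraMap_reducedNorm_eq_det_mulRight h1,
    ← LinearMap.det_restrictScalars]
  rfl

/-- The additive group of `A`, for use as a right module over a subfield. -/
def RightSelf (A : Type*) := Aᵐᵒᵖ

instance (A : Type*) [Ring A] : AddCommGroup (RightSelf A) := inferInstanceAs (AddCommGroup Aᵐᵒᵖ)

instance (K A : Type*) [Field K] [Ring A] [Algebra K A] : Module K (RightSelf A) :=
  inferInstanceAs (Module K Aᵐᵒᵖ)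

/-- Over `K`, right multiplication by x has a power of the reduced norm as determinant. It is also a
scalar for the right `E`-structure, carried by `RightSelf A` to keep it apart from the left one, so
the same determinant is a power of the field norm. The ambiguity left by the n-th powers is harmless
later. -/
theorem reducedNorm_smul_one_pow [FiniteDimensional K E] (h1 : Module.finrank E A = CentralSimple.degree K A)
    (h2 : Module.finrank K E = CentralSimple.degree K A) (x : E) :
    reducedNorm K A (x • 1) ^ CentralSimple.degree K A =
      Algebra.norm K x ^ CentralSimple.degree K A := by
  let f : E →+* Aᵐᵒᵖ :=
    { toFun := fun e => .op (e • 1)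
      map_one' := by simp
      map_zero' := by simp
      map_add' := fun x y => by simp [add_smul]
      map_mul' := fun x y => by
        rw [← MulOpposite.op_mul, smul_mul_assoc, one_mul, smul_smul, mul_comm] }
  let _ : Module E (RightSelf A) := Module.compHom Aᵐᵒᵖ f
  have : IsScalarTower K E (RightSelf A) := ⟨fun k e a => by
    have hf : f (k • e) = k • f e := MulOpposite.unop_injective (smul_assoc k e (1 : A))
    let a' : Aᵐᵒᵖ := a
    have h : f (k • e) * a' = k • (f e * a') := by rw [hf, smul_mul_assoc]
    exact h⟩
  let g : A ≃ₗ[K] RightSelf A := MulOpposite.opLinearEquiv K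
  have h3 : Module.finrank E (RightSelf A) = CentralSimple.degree K A := by
    have h4 := Module.finrank_mul_finrank K E (RightSelf A)
    rw [h2, ← g.finrank_eq, ← CentralSimple.degree_sq K A, sq] at h4
    exact Nat.eq_of_mul_eq_mul_left (h2 ▸ Module.finrank_pos) h4
  nth_rw 1 [← h2]
  rw [reducedNorm_pow_finrank h1, ← h3, ← det_lsmul_eq_norm_pow, ← LinearMap.det_conj _ g]
  rfl

/-- Right multiplication by a has nonzero determinant, hence is bijective: surjectivity gives a left
inverse, and injectivity makes it two-sided. -/
theorem isUnit_of_reducedNorm_ne_zero [FiniteDimensional K E] (h1 : Module.finrank E A = CentralSimple.degree K A) {a : A}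
    (ha : reducedNorm K A a ≠ 0) : IsUnit a := by
  have h := pow_ne_zero (Module.finrank K E) ha
  rw [reducedNorm_pow_finrank h1] at h
  have hb := LinearEquiv.bijective (LinearMap.equivOfDetNeZero _ h)
  obtain ⟨b, hb1⟩ := hb.2 1
  have hb1 : b * a = 1 := hb1
  refine ⟨⟨a, b, hb.1 (?_ : a * b * a = 1 * a), hb1⟩, rfl⟩
  rw [mul_assoc, hb1, mul_one, one_mul]

theorem continuous_reducedNorm [FiniteDimensional K E] [TopologicalSpace K] [IsTopologicalRing K] [TopologicalSpace A]
    [IsModuleTopology K A] (h1 : Module.finrank E A = CentralSimple.degree K A) :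
    Continuous (reducedNorm K A) := by
  have : FiniteDimensional E A := Module.Finite.of_restrictScalars_finite K E A
  let b := Module.finBasisOfFinrankEq E A h1
  -- A `K`-linear retraction of `E` onto `K` recovers the reduced norm from a determinant over `E`.
  obtain ⟨lam, hlam⟩ := LinearMap.exists_leftInverse_of_injective (Algebra.linearMap K E)
    (LinearMap.ker_eq_bot.2 (algebraMap K E).injective)
  let _ : TopologicalSpace E := moduleTopology K E
  have : IsModuleTopology K E := ⟨rfl⟩
  have : IsTopologicalRing E := IsModuleTopology.isTopologicalRing K E
  have h2 : reducedNorm K A = fun a => lam ((mulRightMatrix K b a).det) := funext fun a => by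
    rw [det_mulRightMatrix, ← algebraMap_reducedNorm_eq_det_mulRight h1]
    exact (LinearMap.congr_fun hlam _).symm
  rw [h2]
  refine (IsModuleTopology.continuous_of_linearMap lam).comp (Continuous.matrix_det ?_)
  exact IsModuleTopology.continuous_of_linearMap (mulRightMatrix K b).toLinearMap

end NormOnSubfield

/-! ### Norms from finite extensions of a local field, separable or not -/

section LocalField

theorem IsNonarchimedeanLocalField.t2Space (K : Type*) [Field K] [ValuativeRel K]
    [TopologicalSpace K] [IsNonarchimedeanLocalField K] : T2Space K := by
  let := IsTopologicalAddGroup.rightUniformSpace K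
  have := isUniformAddGroup_of_addCommGroup (G := K)
  have : T0Space K := ValuedRing.separated (Γ₀ := ValueGroupWithZero K)
  infer_instance

-- Inverse function theorem at 0, for the norm defined by the rank one valuation.
open Polynomial in
theorem eventually_exists_eval_eq (K : Type*) [Field K] [ValuativeRel K] [TopologicalSpace K]
    [IsNonarchimedeanLocalField K] (f : K[X]) (hf : (derivative f).eval 0 ≠ 0) :
    ∀ᶠ s in nhds (f.eval 0), ∃ t, f.eval t = s := by
  let := IsTopologicalAddGroup.rightUniformSpace K
  have := isUniformAddGroup_of_addCommGroup (G := K)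
  let : (Valued.v (R := K)).RankOne :=
    { hom' := IsRankLeOne.nonempty.some.emb (R := K).comp MonoidWithZeroHom.ValueGroup₀.embedding
      strictMono' := IsRankLeOne.nonempty.some.strictMono.comp
        MonoidWithZeroHom.ValueGroup₀.embedding_strictMono }
  let := Valued.toNontriviallyNormedField K (ValueGroupWithZero K)
  have h := (f.hasStrictDerivAt (0 : K)).map_nhds_eq hf
  rw [← h]
  exact Filter.eventually_map.2 (Filter.Eventually.of_forall fun t => ⟨t, rfl⟩)

/-- Put q = p ^ k and let w be a q-th root of ϖ. By separability the q-th powers of `F` span `F`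
over `K`, and ϖ handles the coefficients, so every element of `F` has a q-th root in F(w). As the
q-th powers of `E` lie in `F`, `E` embeds in F(w), whose degree is at most q = [E : F]. Hence the
two coincide. -/
theorem exists_pow_eq_of_isPurelyInseparable (K F E : Type*) [Field K] [Field F] [Field E]
    [Algebra K F] [Algebra F E] [Algebra.IsSeparable K F] [IsPurelyInseparable F E]
    [FiniteDimensional F E] (p k : ℕ) [ExpChar K p] (hq : Module.finrank F E = p ^ k) (ϖ : K)
    (hϖ : ∀ x : K, ∃ a : ℕ → K, x = ∑ i ∈ Finset.range (p ^ k), ϖ ^ i * a i ^ p ^ k) (y : F) :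
    ∃ x : E, x ^ p ^ k = algebraMap F E y := by
  have : ExpChar F p := expChar_of_injective_algebraMap (algebraMap K F).injective p
  let Ω := AlgebraicClosure E
  have : ExpChar Ω p := expChar_of_injective_algebraMap (algebraMap F Ω).injective p
  have hp0 : p ^ k ≠ 0 := hq ▸ Module.finrank_pos.ne'
  obtain ⟨w, hw⟩ := IsAlgClosed.exists_pow_nat_eq (algebraMap F Ω (algebraMap K F ϖ))
    (Nat.pos_of_ne_zero hp0)
  let M : IntermediateField F Ω := IntermediateField.adjoin F {w}
  have hwM : w ∈ M := IntermediateField.mem_adjoin_simple_self F w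
  have hroot : ∀ y : F, ∃ z ∈ M, z ^ p ^ k = algebraMap F Ω y := by
    intro y
    have htop := Field.span_map_pow_expChar_pow_eq_top_of_isSeparable (F := K) (E := F) p k
      (v := id) (by simp)
    have hy : y ∈ Submodule.span K (Set.range fun x : F => id x ^ p ^ k) := htop ▸ trivial
    induction hy using Submodule.span_induction with
    | mem y hy =>
      obtain ⟨x, rfl⟩ := hy
      exact ⟨algebraMap F Ω x, M.algebraMap_mem x, by simp⟩
    | zero => exact ⟨0, M.zero_mem, by rw [zero_pow hp0, map_zero]⟩
    | add x y _ _ hx hy =>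
      obtain ⟨a, ha, hax⟩ := hx
      obtain ⟨b, hb, hby⟩ := hy
      exact ⟨a + b, M.add_mem ha hb, by rw [add_pow_expChar_pow, hax, hby, map_add]⟩
    | smul c x _ hx =>
      obtain ⟨z, hz, hzx⟩ := hx
      obtain ⟨a, ha⟩ := hϖ c
      refine ⟨(∑ i ∈ Finset.range (p ^ k), w ^ i * algebraMap F Ω (algebraMap K F (a i))) * z,
        M.mul_mem (M.sum_mem fun i _ => M.mul_mem (pow_mem hwM i) (M.algebraMap_mem _)) hz, ?_⟩
      rw [mul_pow, sum_pow_char_pow, hzx, Algebra.smul_def, map_mul, ha]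
      simp only [map_sum, map_mul, map_pow, mul_pow, ← hw]
      congr 1
      exact Finset.sum_congr rfl fun i _ => by rw [pow_right_comm]
  have hdeg : Module.finrank F M ≤ p ^ k := by
    rw [IntermediateField.adjoin.finrank (Algebra.IsIntegral.isIntegral w)]
    refine (Polynomial.natDegree_le_of_dvd (minpoly.dvd F w (p := Polynomial.X ^ p ^ k -
      Polynomial.C (algebraMap K F ϖ)) (by simp [hw])) (Polynomial.X_pow_sub_C_ne_zero
        (Nat.pos_of_ne_zero hp0) _)).trans_eq Polynomial.natDegree_X_pow_sub_C
  let i : E →ₐ[F] Ω := IsScalarTower.toAlgHom F E Ω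
  have hinj : ∀ a b : Ω, a ^ p ^ k = b ^ p ^ k → a = b := fun a b h => iterateFrobenius_inj Ω p k h
  have hle : i.fieldRange ≤ M := by
    rintro _ ⟨x, rfl⟩
    obtain ⟨y, hy⟩ : ∃ y : F, x ^ p ^ k = algebraMap F E y := by
      obtain ⟨n, y, hxy⟩ := IsPurelyInseparable.minpoly_eq_X_pow_sub_C F p x
      have h1 : x ^ p ^ n = algebraMap F E y := by
        have := minpoly.aeval F x
        rwa [hxy, map_sub, map_pow, Polynomial.aeval_X, Polynomial.aeval_C, sub_eq_zero] at this
      have h2 := minpoly.degree_dvd (K := F) (Algebra.IsIntegral.isIntegral x)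
      rw [hxy, Polynomial.natDegree_X_pow_sub_C, hq] at h2
      obtain ⟨c, hc⟩ := h2
      exact ⟨y ^ c, by rw [hc, pow_mul, h1, map_pow]⟩
    obtain ⟨z, hz, hzy⟩ := hroot y
    have : i x = z := hinj _ _ (by rw [hzy, ← map_pow, hy]; exact i.commutes y)
    exact this ▸ hz
  have : FiniteDimensional F M := IntermediateField.adjoin.finiteDimensional
    (Algebra.IsIntegral.isIntegral w)
  have heq : i.fieldRange = M := IntermediateField.eq_of_le_of_finrank_le hle <| by
    exact hdeg.trans (hq ▸ (AlgEquiv.ofInjectiveField i).toLinearEquiv.finrank_eq).le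
  obtain ⟨z, hz, hzy⟩ := hroot y
  obtain ⟨x, rfl⟩ := heq.symm ▸ hz
  exact ⟨x, i.injective (by rw [map_pow]; exact hzy.trans (i.commutes y).symm)⟩

/-- The residue field is perfect, so every integer is a q-th power modulo the uniformizer ϖ, where q
= p ^ k. Iterating approximates integers by sums of the required form with integral entries. Such
sums form a compact, hence closed, set. -/
theorem exists_eq_sum_uniformizer_pow (K : Type*) [Field K] [ValuativeRel K] [TopologicalSpace K]
    [IsNonarchimedeanLocalField K] (p k : ℕ) [hp : ExpChar K p] :
    ∃ ϖ : K, ∀ x : K, ∃ a : ℕ → K, x = ∑ i ∈ Finset.range (p ^ k), ϖ ^ i * a i ^ p ^ k := by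
  rcases hp with _ | hp
  · exact ⟨0, fun x => ⟨fun _ => x, by simp⟩⟩
  have : Fact p.Prime := ⟨hp⟩
  have := IsNonarchimedeanLocalField.t2Space K
  have : CharP 𝒪[K] p := (algebraMap 𝒪[K] K).charP (FaithfulSMul.algebraMap_injective _ _) p
  have : CharP 𝓀[K] p := (CharP.charP_iff_prime_eq_zero hp).2 (by
    rw [← map_natCast (IsLocalRing.residue 𝒪[K]), CharP.cast_eq_zero, map_zero])
  obtain ⟨ϖ, hϖ⟩ := IsDiscreteValuationRing.exists_irreducible 𝒪[K]
  set q := p ^ k with hq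
  have hq0 : 0 < q := pow_pos hp.pos k
  have digit : ∀ y : 𝒪[K], ∃ a z : 𝒪[K], y = a ^ q + ϖ * z := by
    intro y
    obtain ⟨b, hb⟩ := (bijective_iterateFrobenius 𝓀[K] p k).2 (IsLocalRing.residue 𝒪[K] y)
    obtain ⟨a, rfl⟩ := IsLocalRing.residue_surjective b
    have h1 : y - a ^ q ∈ IsLocalRing.maximalIdeal 𝒪[K] := by
      rw [← IsLocalRing.residue_eq_zero_iff, map_sub, map_pow, ← hb, iterateFrobenius_def, sub_self]
    rw [hϖ.maximalIdeal_eq, Ideal.mem_span_singleton] at h1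
    obtain ⟨z, hz⟩ := h1
    exact ⟨a, z, by rw [← hz]; ring⟩
  let g : (Fin q → 𝒪[K]) → K := fun a => ∑ i : Fin q, (ϖ : K) ^ (i : ℕ) * (a i : K) ^ q
  have hg : Continuous g := by
    unfold g
    fun_prop
  have hcl : IsClosed (Set.range g) := (isCompact_range hg).isClosed
  have hadd : ∀ a b, g (a + b) = g a + g b := fun a b => by
    simp only [g, ← Finset.sum_add_distrib, ← mul_add, Pi.add_apply, hq, Subring.coe_add]
    exact Finset.sum_congr rfl fun i _ => by rw [add_pow_expChar_pow]
  have hsingle : ∀ (j : ℕ) (c : 𝒪[K]), ∃ a, g a = (ϖ : K) ^ j * (c : K) ^ q := fun j c => by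
    -- Exponents from q on are folded back: the multiple of q in j goes into the q-th power.
    refine ⟨Pi.single ⟨j % q, Nat.mod_lt _ hq0⟩ (ϖ ^ (j / q) * c), ?_⟩
    simp only [g]
    rw [Finset.sum_eq_single ⟨j % q, Nat.mod_lt _ hq0⟩]
    · rw [Pi.single_eq_same]
      push_cast
      rw [mul_pow, ← pow_mul, ← mul_assoc, ← pow_add, Nat.mod_add_div']
    · intro i _ hi
      rw [Pi.single_eq_of_ne hi]
      simp [hq0.ne']
    · simp
  have happrox : ∀ (y : 𝒪[K]) (N : ℕ), ∃ a z, (y : K) = g a + (ϖ : K) ^ N * (z : 𝒪[K]) := by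
    intro y N
    induction N with
    | zero => exact ⟨0, y, by simp [g, hq0.ne']⟩
    | succ N ih =>
      obtain ⟨a, z, h1⟩ := ih
      obtain ⟨c, w, rfl⟩ := digit z
      obtain ⟨b, hb⟩ := hsingle N c
      refine ⟨a + b, w, ?_⟩
      rw [h1, hadd, hb]
      push_cast
      ring
  have hint : ∀ y : 𝒪[K], ∃ a, g a = y := by
    intro y
    choose a z h using happrox y
    have hlim : Filter.Tendsto (fun N => g (a N)) Filter.atTop (nhds (y : K)) := by
      rw [← tendsto_sub_nhds_zero_iff]
      refine (IsValuativeTopology.hasBasis_nhds_zero' K).tendsto_right_iff.2 fun γ hγ => ?_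
      have hv : valuation K (ϖ : K) < 1 := Valuation.integer.v_irreducible_lt_one hϖ
      obtain ⟨n, hn⟩ := exists_pow_lt₀ hv (Units.mk0 γ hγ)
      filter_upwards [Filter.eventually_ge_atTop n] with N hN
      have h2 : g (a N) - y = -((ϖ : K) ^ N * (z N : K)) := by rw [h N]; ring
      change valuation K (g (a N) - y) < γ
      rw [h2, Valuation.map_neg, map_mul, map_pow]
      calc _ ≤ valuation K (ϖ : K) ^ N * 1 := mul_le_mul_right (z N).2 _
        _ ≤ valuation K (ϖ : K) ^ n := by
          rw [mul_one]; exact pow_le_pow_right_of_le_one' hv.le hN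
        _ < γ := hn
    exact hcl.mem_of_tendsto hlim (Filter.Eventually.of_forall fun N => ⟨_, rfl⟩)
  refine ⟨ϖ, fun x => ?_⟩
  -- Denominators are cleared by a q-th power, which preserves the form of the sum. For non-integral
  -- x, d = x⁻¹ works.
  obtain ⟨d, hd, y, hy⟩ : ∃ d : K, d ≠ 0 ∧ ∃ y : 𝒪[K], (y : K) = d ^ q * x := by
    rcases le_total (valuation K x) 1 with hx | hx
    · exact ⟨1, one_ne_zero, ⟨x, hx⟩, by simp⟩
    · have hx0 : x ≠ 0 := by rintro rfl; simp at hx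
      have hx1 : valuation K x⁻¹ ≤ 1 := by
        rw [map_inv₀]
        exact inv_le_one_of_one_le₀ hx
      refine ⟨x⁻¹, inv_ne_zero hx0, ⟨x⁻¹, hx1⟩ ^ (q - 1), ?_⟩
      push_cast
      obtain ⟨r, hr⟩ : ∃ r, q = r + 1 := ⟨q - 1, by omega⟩
      rw [hr, Nat.add_sub_cancel, pow_succ, mul_assoc, inv_mul_cancel₀ hx0, mul_one]
  obtain ⟨a, ha⟩ := hint y
  refine ⟨fun i => if h : i < q then d⁻¹ * a ⟨i, h⟩ else 0, ?_⟩
  rw [Finset.sum_range]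
  have h1 : x = (d⁻¹) ^ q * g a := by
    rw [ha, hy, ← mul_assoc, ← mul_pow, inv_mul_cancel₀ hd, one_pow, one_mul]
  rw [h1, Finset.mul_sum]
  refine Finset.sum_congr rfl fun i _ => ?_
  simp only [Fin.is_lt, dif_pos, Fin.eta]
  ring

theorem exists_eq_expChar_pow_mul (K : Type*) [Field K] (p : ℕ) [hp : ExpChar K p] (n : ℕ)
    (hn : n ≠ 0) : ∃ j m : ℕ, n = p ^ j * m ∧ (m : K) ≠ 0 := by
  rcases hp with _ | hp
  · exact ⟨0, n, by simp, by exact_mod_cast hn⟩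
  · obtain ⟨j, m, hm, rfl⟩ := Nat.exists_eq_pow_mul_and_not_dvd hn p hp.ne_one
    exact ⟨j, m, rfl, fun h => hm ((CharP.cast_eq_zero_iff K p m).1 h)⟩

open Polynomial in
/-- Norms from a finite extension of a local field fill up a neighbourhood of `1`. As `n`-th powers
determine elements only up to roots of unity, this is stated for `n`-th roots of the `n`-th powers
of norms. -/
theorem eventually_exists_norm_pow_eq (K E : Type*) [Field K] [ValuativeRel K]
    [TopologicalSpace K] [IsNonarchimedeanLocalField K] [Field E] [Algebra K E]
    [FiniteDimensional K E] (n : ℕ) (hn : n ≠ 0) :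
    ∃ m : ℕ, ∀ᶠ s in nhds (1 : K), ∃ x : E, x ≠ 0 ∧
      ∀ c : K, c ^ n = Algebra.norm K x ^ n → c ^ m = s := by
  have := IsNonarchimedeanLocalField.t2Space K
  let p := ringExpChar K
  let F := separableClosure K E
  obtain ⟨k, hk⟩ := IsPurelyInseparable.finrank_eq_pow F E p
  obtain ⟨ϖ, hϖ⟩ := exists_eq_sum_uniformizer_pow K p k
  have hp0 : p ^ k ≠ 0 := hk ▸ Module.finrank_pos.ne'
  -- Injectivity of Frobenius removes the factor p ^ j; the remaining exponent m is nonzero in `K`,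
  -- so the m-th power has nonzero derivative at 1.
  obtain ⟨j, m, hjm, hm⟩ := exists_eq_expChar_pow_mul K p (p ^ k * n) (mul_ne_zero hp0 hn)
  have hm0 : m ≠ 0 := by rintro rfl; simp at hm
  -- The derivative at t = 0 of the norm of 1 + t a is the trace of a, here 1.
  obtain ⟨a, ha⟩ := Algebra.trace_surjective K F 1
  let b := Module.finBasis K F
  let M := Algebra.leftMulMatrix b a
  let f : K[X] := (1 + (X : K[X]) • M.map C).det ^ m
  have hdet : ∀ t, (1 + (X : K[X]) • M.map C).det.eval t = Algebra.norm K (1 + t • a) := fun t => by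
    rw [Algebra.norm_eq_matrix_det b, map_add, map_one, map_smul, ← coe_evalRingHom,
      RingHom.map_det]
    congr 1
    ext i j
    simp [Matrix.one_apply, apply_ite (eval t), M]
    exact mul_comm _ _
  have hf : ∀ t, f.eval t = Algebra.norm K (1 + t • a) ^ m := fun t => by
    rw [eval_pow, hdet]
  have hf0 : f.eval 0 = 1 := by rw [hf]; simp
  have hf1 : (derivative f).eval 0 ≠ 0 := by
    have h0 : (1 + (X : K[X]) • M.map C).det.eval 0 = 1 := by rw [hdet]; simp
    rw [derivative_pow, eval_mul, eval_mul, Matrix.derivative_det_one_add_X_smul, eval_pow, h0,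
      ← Algebra.trace_eq_matrix_trace, ha]
    simpa using hm
  refine ⟨m, ?_⟩
  have h1 := eventually_exists_eval_eq K f hf1
  rw [hf0] at h1
  filter_upwards [h1, isOpen_ne.mem_nhds (one_ne_zero : (1 : K) ≠ 0)] with s ⟨t, ht⟩ hs
  obtain ⟨x, hx⟩ := exists_pow_eq_of_isPurelyInseparable K F E p k hk ϖ hϖ (1 + t • a)
  have hN : Algebra.norm K x ^ p ^ k = Algebra.norm K (1 + t • a) ^ p ^ k := by
    rw [← map_pow, hx, ← Algebra.norm_norm (S := F), Algebra.norm_algebraMap, hk, map_pow]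
  rw [hf] at ht
  refine ⟨x, ?_, fun c hc => ?_⟩
  · rintro rfl
    rw [zero_pow hp0, eq_comm, map_eq_zero] at hx
    rw [hx, Algebra.norm_zero, zero_pow hm0] at ht
    exact hs ht.symm
  · rw [← ht]
    refine iterateFrobenius_inj K p j ?_
    simp only [iterateFrobenius_def]
    rw [← pow_mul, mul_comm m, ← hjm, mul_comm, pow_mul, hc, ← pow_mul, mul_comm, pow_mul, hN,
      ← pow_mul, hjm, mul_comm, pow_mul]

end LocalField

/-! ### Casimir elements and intertwiners -/

section Rigidity

/-- A Casimir element of a finite field extension. -/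
theorem exists_casimir (K E M : Type*) [Field K] [Field E] [Algebra K E] [FiniteDimensional K E]
    [AddCommGroup M] [Module K M] :
    ∃ x y : Module.Basis (Fin (Module.finrank K E)) K E,
      ∀ (z : E) (T : E →ₗ[K] E →ₗ[K] M), ∑ i, T (z * x i) (y i) = ∑ i, T (x i) (z * y i) := by
  -- Any functional with value 1 at 1 gives a nondegenerate form lam(xy), whereas the trace form
  -- degenerates for inseparable `E`. The Casimir element pairs a basis with its dual.
  obtain ⟨lam, hlam⟩ := LinearMap.exists_leftInverse_of_injective (Algebra.linearMap K E)
    (LinearMap.ker_eq_bot.2 (algebraMap K E).injective)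
  have hlam1 : lam 1 = 1 := by simpa using LinearMap.congr_fun hlam 1
  let B : LinearMap.BilinForm K E := (LinearMap.mul K E).compr₂ lam
  have hBapply : ∀ x y, B x y = lam (x * y) := fun _ _ => rfl
  have hl : ∀ x, (∀ y, B x y = 0) → x = 0 := fun x h => by
    by_contra hx
    have := h x⁻¹
    rw [hBapply, mul_inv_cancel₀ hx, hlam1] at this
    exact one_ne_zero this
  have hB : B.Nondegenerate :=
    ⟨hl, fun y h => hl y fun x => by rw [hBapply, mul_comm]; exact h x⟩
  have hBs : B.IsSymm := ⟨fun x y => by rw [hBapply, hBapply, mul_comm]⟩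
  let x := Module.finBasis K E
  let y := B.dualBasis hB x
  have hx : ∀ z i, z * x i = ∑ j, B (z * x i) (y j) • x j := fun z i => by
    have hxy : B.dualBasis hB y = x := LinearMap.BilinForm.dualBasis_dualBasis hB hBs x
    conv_lhs => rw [← x.sum_repr (z * x i)]
    refine Finset.sum_congr rfl fun j _ => ?_
    rw [← LinearMap.BilinForm.dualBasis_repr_apply hB, hxy]
  have hy : ∀ z j, z * y j = ∑ i, B (z * y j) (x i) • y i := fun z j => by
    conv_lhs => rw [← y.sum_repr (z * y j)]
    simp only [y, LinearMap.BilinForm.dualBasis_repr_apply]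
  refine ⟨x, y, fun z T => ?_⟩
  calc ∑ i, T (z * x i) (y i) = ∑ i, ∑ j, B (z * x i) (y j) • T (x j) (y i) := by
        refine Finset.sum_congr rfl fun i _ => ?_
        conv_lhs => rw [hx]
        simp
    _ = ∑ j, ∑ i, B (z * y j) (x i) • T (x j) (y i) := by
        rw [Finset.sum_comm]
        refine Finset.sum_congr rfl fun j _ => Finset.sum_congr rfl fun i _ => ?_
        rw [hBapply, hBapply]
        congr 2
        ring
    _ = _ := by
        refine Finset.sum_congr rfl fun j _ => ?_
        conv_rhs => rw [hy]
        simp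

variable {K A E : Type*} [Field K] [Ring A] [Algebra K A] [Field E] [Algebra K E] [Module E A]
  [IsScalarTower K E A] [IsScalarTower E A A] [FiniteDimensional K A] [FiniteDimensional K E]
  [Algebra.IsCentral K A] [IsSimpleRing A]

/-- The Casimir identity moves z across the sum, which gives the intertwining relation for every a.
Faithfulness of the action of E ⊗ Aᵐᵒᵖ provides an a for which the sum at ψ = σ is nonzero. -/
theorem exists_intertwiner (hE : ∀ l : ℕ, l.Prime → ∃ a : E, ∀ b : E, b ^ l ≠ a)
    (hmax : ActsAsMaximalSubfield K A E) (σ : E →ₐ[K] E) :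
    ∃ (d : ℕ) (x y : Fin d → E) (a : A), ∑ i, σ (x i) • (a * σ (y i) • (1 : A)) = 1 ∧
      ∀ (ψ : E →ₐ[K] A) (z : E),
        σ z • ∑ i, σ (x i) • (a * ψ (y i)) = (∑ i, σ (x i) • (a * ψ (y i))) * ψ z := by
  classical
  obtain ⟨x, y, hxy⟩ := exists_casimir K E A
  have hint : ∀ (a : A) (ψ : E →ₐ[K] A) (z : E),
      σ z • ∑ i, σ (x i) • (a * ψ (y i)) = (∑ i, σ (x i) • (a * ψ (y i))) * ψ z := by
    intro a ψ z
    let T : E →ₗ[K] E →ₗ[K] A := LinearMap.mk₂ K (fun u v => σ u • (a * ψ v))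
      (fun _ _ _ => by rw [map_add, add_smul]) (fun _ _ _ => by rw [map_smul, smul_assoc])
      (fun _ _ _ => by rw [map_add, mul_add, smul_add])
      (fun _ _ _ => by rw [map_smul, mul_smul_comm, smul_comm])
    have h := hxy z T
    simp only [T, LinearMap.mk₂_apply, map_mul, mul_smul] at h
    rw [Finset.smul_sum, h, Finset.sum_mul]
    refine Finset.sum_congr rfl fun i _ => ?_
    rw [← map_mul, mul_comm z, map_mul, smul_mul_assoc, mul_assoc]
  let σA : E →ₐ[K] A :=
    { toFun := fun z => σ z • 1
      map_one' := by simp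
      map_zero' := by simp
      map_add' := fun u v => by rw [map_add, add_smul]
      map_mul' := fun u v => by rw [map_mul, mul_smul, smul_mul_assoc, one_mul]
      commutes' := fun k => by rw [σ.commutes, algebraMap_smul, Algebra.algebraMap_eq_smul_one] }
  have hσ : Function.Bijective σ := σ.bijective
  obtain ⟨a, ha⟩ : ∃ a : A, ∑ i, σ (x i) • (a * σ (y i) • (1 : A)) ≠ 0 := by
    refine exists_sum_mul_ne_zero (K := K) (fun i => σ (x i))
      (fun i => MulOpposite.op (σ (y i) • (1 : A))) fun h0 => ?_
    let xσ : Module.Basis (Fin (Module.finrank K E)) K E :=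
      x.map (LinearEquiv.ofBijective σ.toLinearMap hσ)
    have h1 := TensorProduct.sum_tmul_basis_left_eq_zero xσ
      (Finsupp.equivFunOnFinite.symm fun i => MulOpposite.op (σ (y i) • (1 : A)))
      (by rw [Finsupp.sum_fintype _ _ fun i => TensorProduct.tmul_zero _ _]; exact h0)
    have i0 : Fin (Module.finrank K E) := ⟨0, Module.finrank_pos⟩
    have h2 : σ (y i0) • (1 : A) = 0 := MulOpposite.op_injective (DFunLike.congr_fun h1 i0)
    rw [smul_eq_zero_iff_left one_ne_zero, map_eq_zero] at h2
    exact y.ne_zero i0 h2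
  -- At ψ = σ the sum commutes with `E`, so it is some e in `E`; replacing a by e⁻¹ • a normalises
  -- it to 1.
  obtain ⟨e, he⟩ := exists_eq_smul_one_of_commute hE hmax _ (fun z => by
    obtain ⟨z, rfl⟩ := hσ.2 z
    exact (hint a σA z).symm)
  have he0 : e ≠ 0 := by
    rintro rfl
    exact ha (he.trans (zero_smul _ _))
  refine ⟨_, x, y, e⁻¹ • a, ?_, hint _⟩
  have : ∑ i, σ (x i) • (e⁻¹ • a * σ (y i) • (1 : A)) =
      e⁻¹ • ∑ i, σ (x i) • (a * σ (y i) • (1 : A)) := by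
    rw [Finset.smul_sum]
    exact Finset.sum_congr rfl fun i _ => by rw [smul_mul_assoc, smul_comm]
  have he' : ∑ i, σ (x i) • (a * σ (y i) • (1 : A)) = e • 1 := he
  rw [this, he', smul_smul, inv_mul_cancel₀ he0, one_smul]

end Rigidity

/-! ### Compactness of the set of embeddings, and the theorem -/

section Main

theorem exists_smul_mem_of_mem_span {K A : Type*} [Field K] [ValuativeRel K] [Ring A] [Algebra K A]
    (H : Subalgebra 𝒪[K] A) {a : A} (ha : a ∈ Submodule.span K (H : Set A)) :
    ∃ c : 𝒪[K], (c : K) ≠ 0 ∧ (c : K) • a ∈ H := by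
  have hsm : ∀ (c : 𝒪[K]) {b : A}, b ∈ H → (c : K) • b ∈ H := fun c b hb => H.smul_mem hb c
  induction ha using Submodule.span_induction with
  | mem h hh => exact ⟨1, by simp, hsm 1 hh⟩
  | zero => exact ⟨1, by simp, by simp⟩
  | add x y _ _ hx hy =>
    obtain ⟨c, hc0, hc⟩ := hx
    obtain ⟨d, hd0, hd⟩ := hy
    refine ⟨c * d, mul_ne_zero hc0 hd0, ?_⟩
    push_cast
    rw [smul_add]
    refine H.add_mem ?_ ?_
    · rw [mul_comm, mul_smul]
      exact hsm d hc
    · rw [mul_smul]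
      exact hsm c hd
  | smul k x _ hx =>
    obtain ⟨c, hc0, hc⟩ := hx
    rcases le_total (valuation K k) 1 with hk | hk
    · exact ⟨c, hc0, by rw [smul_comm]; exact hsm ⟨k, hk⟩ hc⟩
    · have hk0 : k ≠ 0 := by rintro rfl; simp at hk
      have hk1 : valuation K k⁻¹ ≤ 1 := by
        rw [map_inv₀]
        exact inv_le_one_of_one_le₀ hk
      refine ⟨c * ⟨k⁻¹, hk1⟩, mul_ne_zero hc0 (inv_ne_zero hk0), ?_⟩
      push_cast
      rwa [mul_smul, smul_smul k⁻¹, inv_mul_cancel₀ hk0, one_smul]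

/-- Embeddings of `E` in `A`, as functions. -/
def algHomFunctions (K E A : Type*) [Field K] [Ring A] [Algebra K A] [Field E] [Algebra K E] :
    Set (E → A) := Set.range fun ψ : E →ₐ[K] A => (ψ : E → A)

theorem isClosed_algHomFunctions {K A E : Type*} [Field K] [Ring A] [Algebra K A] [Field E]
    [Algebra K E] [TopologicalSpace K] [IsTopologicalRing K] [FiniteDimensional K A]
    [TopologicalSpace A] [T2Space A] [IsModuleTopology K A] :
    IsClosed (algHomFunctions K E A) := by
  have := IsModuleTopology.isTopologicalRing K A
  have heq : algHomFunctions K E A =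
      {ψ | ψ 1 = 1} ∩ (⋂ p : E × E, {ψ | ψ (p.1 + p.2) = ψ p.1 + ψ p.2})
      ∩ (⋂ p : E × E, {ψ | ψ (p.1 * p.2) = ψ p.1 * ψ p.2})
      ∩ ⋂ k : K, {ψ | ψ (algebraMap K E k) = algebraMap K A k} := by
    ext ψ
    constructor
    · rintro ⟨ψ, rfl⟩
      simp
    · rintro ⟨⟨⟨h1, h2⟩, h3⟩, h4⟩
      simp only [Set.mem_iInter, Set.mem_ofPred_eq] at h1 h2 h3 h4
      exact ⟨{ toFun := ψ
               map_one' := h1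
               map_zero' := by simpa using h4 0
               map_add' := fun x y => h2 (x, y)
               map_mul' := fun x y => h3 (x, y)
               commutes' := h4 }, rfl⟩
  rw [heq]
  refine ((IsClosed.inter ?_ (isClosed_iInter fun p => ?_)).inter (isClosed_iInter fun p => ?_)).inter
    (isClosed_iInter fun k => ?_) <;> exact isClosed_eq (by fun_prop) (by fun_prop)

variable {K A E : Type*} [Field K] [ValuativeRel K] [TopologicalSpace K]
  [IsNonarchimedeanLocalField K] [Ring A] [Algebra K A] [Field E] [Algebra K E] [Module E A]
  [IsScalarTower K E A] [IsScalarTower E A A] [FiniteDimensional K A] [FiniteDimensional K E]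
  [Algebra.IsCentral K A] [IsSimpleRing A]

/-- Reduced norm and field norm of x are only known to have equal n-th powers, n being the degree.
The exponent m absorbs the ambiguity, so x ^ m is the element sought. -/
theorem eventually_exists_reducedNorm_smul_one_eq (hmax : ActsAsMaximalSubfield K A E) :
    ∀ᶠ s in nhds (1 : K), ∃ x : E, x ≠ 0 ∧ reducedNorm K A (x • 1) = s := by
  obtain ⟨h1, h2⟩ := finrank_eq_degree (exists_forall_pow_ne K E) hmax
  obtain ⟨m, hm⟩ := eventually_exists_norm_pow_eq K E (CentralSimple.degree K A)
    (h2 ▸ Module.finrank_pos.ne')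
  filter_upwards [hm] with s ⟨x, hx0, hx⟩
  refine ⟨x ^ m, pow_ne_zero m hx0, ?_⟩
  rw [← hx _ (reducedNorm_smul_one_pow h1 h2 x), ← map_pow]
  exact congrArg _ (map_pow (RingHom.smulOneHom : E →+* A) x m)

omit [ValuativeRel K] [TopologicalSpace K] [IsNonarchimedeanLocalField K] [FiniteDimensional K A]
  [FiniteDimensional K E] [Algebra.IsCentral K A] [IsSimpleRing A] in
theorem smul_one_mul_smul_one (p q : E) : p • (1 : A) * q • (1 : A) = (p * q) • (1 : A) := by
  rw [smul_one_mul, smul_smul]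

/-- The inclusion of `E` in `A`, conjugated by a unit of `A`. -/
def conjInclusion (K E : Type*) {A : Type*} [Field K] [Ring A] [Algebra K A] [Field E] [Algebra K E]
    [Module E A] [IsScalarTower K E A] [IsScalarTower E A A] (u : Aˣ) : E →ₐ[K] A where
  toFun z := ↑u⁻¹ * z • (1 : A) * u
  map_one' := by simp
  map_zero' := by simp
  map_add' p q := by simp only [add_smul, mul_add, add_mul]
  map_mul' p q := by
    simp only [← smul_one_mul_smul_one p q, mul_assoc, Units.mul_inv_cancel_left]
  commutes' k := by
    rw [algebraMap_smul, mul_smul_comm, smul_mul_assoc, mul_one, u.inv_mul,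
      Algebra.algebraMap_eq_smul_one]

/-- An embedding of `E` in `A` that is conjugate to the inclusion and close to an automorphism `σ`
of `E` is conjugate to the inclusion by a unit with the same reduced norm as one inducing `σ`. -/
theorem eventually_exists_unit_of_conj [TopologicalSpace A] [IsModuleTopology K A]
    (hmax : ActsAsMaximalSubfield K A E) (σ : E →ₐ[K] E) :
    ∀ᶠ ψ in nhds (fun z : E => σ z • (1 : A)), ∀ u : Aˣ,
      (∀ z, ψ z = ↑u⁻¹ * z • (1 : A) * u) → ∃ w : Aˣ,
        reducedNorm K A w = reducedNorm K A u ∧ ∀ z : E, ↑w⁻¹ * z • (1 : A) * w = σ z • (1 : A) := by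
  obtain ⟨h1, h2⟩ := finrank_eq_degree (exists_forall_pow_ne K E) hmax
  obtain ⟨d, x, y, a, ha, ht⟩ := exists_intertwiner (exists_forall_pow_ne K E) hmax σ
  have := IsModuleTopology.isTopologicalRing K A
  have := IsNonarchimedeanLocalField.t2Space K
  let t : (E → A) → A := fun ψ => ∑ i, σ (x i) • (a * ψ (y i))
  have hsm : ∀ e : E, Continuous fun b : A => e • b := fun e =>
    IsModuleTopology.continuous_of_linearMap ((LinearMap.lsmul E A e).restrictScalars K)
  have hcont : Continuous fun ψ => reducedNorm K A (t ψ) := by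
    refine (continuous_reducedNorm h1).comp (continuous_finsetSum _ fun i _ => (hsm _).comp ?_)
    fun_prop
  have hev := hcont.tendsto (fun z : E => σ z • (1 : A))
  rw [show t (fun z : E => σ z • (1 : A)) = 1 from ha, map_one] at hev
  filter_upwards [hev.eventually (eventually_exists_reducedNorm_smul_one_eq hmax),
    hev.eventually (isOpen_ne.mem_nhds (one_ne_zero : (1 : K) ≠ 0))] with ψ ⟨l, hl0, hl⟩ h0 u hu
  obtain ⟨τ, hτ⟩ := isUnit_of_reducedNorm_ne_zero h1 h0
  have hint : ∀ z, σ z • (τ : A) = τ * ψ z := fun z => by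
    have hψ : ψ = conjInclusion K E u := funext hu
    rw [hτ, hψ]
    exact ht (conjInclusion K E u) z
  have hlu : (l • (1 : A)) * (l⁻¹ • (1 : A)) = 1 := by
    rw [smul_one_mul_smul_one, mul_inv_cancel₀ hl0, one_smul]
  have hul : (l⁻¹ • (1 : A)) * (l • (1 : A)) = 1 := by
    rw [smul_one_mul_smul_one, inv_mul_cancel₀ hl0, one_smul]
  let lu : Aˣ := ⟨l • 1, l⁻¹ • 1, hlu, hul⟩
  -- The factor l cancels the reduced norm of τ⁻¹ and commutes with `E`, while τ⁻¹ turns ψ into σ.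
  refine ⟨lu * (u * τ⁻¹), ?_, fun z => ?_⟩
  · have h3 : reducedNorm K A (lu : A) = reducedNorm K A (τ : A) := by rw [hτ]; exact hl
    have h4 : reducedNorm K A (τ : A) * reducedNorm K A (↑τ⁻¹ : A) = 1 := by
      rw [← map_mul, τ.mul_inv, map_one]
    rw [Units.val_mul, Units.val_mul, map_mul, map_mul, h3, mul_left_comm, h4, mul_one]
  · have h5 : (↑lu⁻¹ : A) * z • (1 : A) * lu = z • 1 := by
      change (l⁻¹ • (1 : A)) * z • (1 : A) * l • (1 : A) = z • 1
      rw [smul_one_mul_smul_one, smul_one_mul_smul_one, mul_right_comm, inv_mul_cancel₀ hl0, one_mul]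
    calc (↑(lu * (u * τ⁻¹))⁻¹ : A) * z • (1 : A) * ↑(lu * (u * τ⁻¹))
        = τ * (↑u⁻¹ * (↑lu⁻¹ * z • (1 : A) * lu) * u) * ↑τ⁻¹ := by
          simp only [mul_inv_rev, inv_inv, Units.val_mul, mul_assoc]
      _ = σ z • (1 : A) := by
          rw [h5, ← hu, ← hint, smul_mul_assoc, τ.mul_inv]

theorem exists_orderNormSet_eq [MetricSpace A] [IsModuleTopology K A]
    (hmax : ActsAsMaximalSubfield K A E) (H : Subalgebra 𝒪[K] A) (hH : IsOrder H)
    (hHE : ∀ h ∈ H, ∃ e : E, h = e • 1)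
    (hspan : ∀ e : E, ∃ c : K, c ≠ 0 ∧ c • e • (1 : A) ∈ H) :
    ∃ ε : ℝ, 0 < ε ∧ ∀ D : Subalgebra 𝒪[K] A, H ≤ D →
      oneSidedHausdorffEDist (D : Set A) (H : Set A) ≤ ENNReal.ofReal ε →
      orderNormSet D H = orderNormSet H H := by
  have := IsModuleTopology.isTopologicalRing K A
  have : ContinuousSMul 𝒪[K] A :=
    ⟨(continuous_smul (M := K) (X := A)).comp (continuous_subtype_val.prodMap continuous_id)⟩
  have hcpt : IsCompact (H : Set A) := Submodule.isCompact_of_fg hH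
  have : LocallyCompactSpace A := by
    let e := (Module.finBasis K A).equivFun
    let f : A ≃ₜ (Fin (Module.finrank K A) → K) :=
      { e.toEquiv with
        continuous_toFun := IsModuleTopology.continuous_of_linearMap e.toLinearMap
        continuous_invFun := IsModuleTopology.continuous_of_linearMap e.symm.toLinearMap }
    exact f.isClosedEmbedding.locallyCompactSpace
  obtain ⟨δ, hδ, hδc⟩ := hcpt.exists_isCompact_cthickening
  let r : ℕ → ℝ := fun n => δ / (n + 1)
  have hr : ∀ n, 0 < r n := fun n => by positivity
  have hranti : Antitone r := fun m n hmn => by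
    simp only [r]
    gcongr
  have hr0 : Filter.Tendsto r Filter.atTop (nhds 0) :=
    (tendsto_const_nhds.div_atTop (tendsto_natCast_atTop_atTop.atTop_add tendsto_const_nhds))
  let Z : ℕ → Set (E → A) := fun n => algHomFunctions K E A ∩
    ⋂ z : {z : E // z • (1 : A) ∈ H}, {ψ | ψ z ∈ Metric.cthickening (r n) (H : Set A)}
  have hZclosed : ∀ n, IsClosed (Z n) := fun n =>
    isClosed_algHomFunctions.inter (isClosed_iInter fun z =>
      Metric.isClosed_cthickening.preimage (continuous_apply _))
  have hZcompact : ∀ n, IsCompact (Z n) := by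
    intro n
    choose c hc0 hc using hspan
    -- Some nonzero multiple c z • z lies in H, which confines ψ z to a rescaled compact thickening;
    -- Tychonoff's theorem applies.
    refine (isCompact_univ_pi (s := fun z => (fun b => (c z)⁻¹ • b) '' Metric.cthickening δ (H : Set A))
      fun z => hδc.image (continuous_const_smul _)).of_isClosed_subset (hZclosed n) ?_
    rintro _ ⟨⟨ψ, rfl⟩, hψ⟩ z -
    refine ⟨c z • ψ z, ?_, ?_⟩
    · have h1 := Set.mem_iInter.1 hψ ⟨c z • z, by rw [smul_assoc]; exact hc z⟩
      have h2 : ψ (c z • z) ∈ Metric.cthickening (r n) (H : Set A) := h1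
      rw [map_smul] at h2
      refine Metric.cthickening_mono ?_ _ h2
      exact div_le_self hδ.le (by linarith [(Nat.cast_nonneg n : (0 : ℝ) ≤ n)])
    · simp [smul_smul, inv_mul_cancel₀ (hc0 z)]
  have hZanti : Antitone Z := fun m n hmn => Set.inter_subset_inter_right _
    (Set.iInter_mono fun z ψ hψ => Metric.cthickening_mono (hranti hmn) _ hψ)
  -- The embeddings for which the desired replacement of u exists. Functions not conjugate to the
  -- inclusion belong vacuously.
  let U : Set (E → A) := {ψ | ∀ u : Aˣ, (∀ z, ψ z = ↑u⁻¹ * z • (1 : A) * u) →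
    ∃ w : Aˣ, reducedNorm K A w = reducedNorm K A u ∧ ∀ h ∈ H, (↑w⁻¹ : A) * h * w ∈ H}
  have hU : ∀ ψ ∈ ⋂ n, Z n, U ∈ nhds ψ := by
    intro ψ hψ
    rw [Set.mem_iInter] at hψ
    obtain ⟨ψ, rfl⟩ := (hψ 0).1
    have hψH : ∀ z : E, z • (1 : A) ∈ H → ψ z ∈ H := by
      intro z hz
      have h1 : ∀ n, Metric.infEDist (ψ z) (H : Set A) ≤ ENNReal.ofReal (r n) := fun n =>
        Set.mem_iInter.1 (hψ n).2 ⟨z, hz⟩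
      have h2 := ge_of_tendsto' (ENNReal.tendsto_ofReal hr0) h1
      rw [ENNReal.ofReal_zero, nonpos_iff_eq_zero, ← Metric.mem_closure_iff_infEDist_zero,
        hcpt.isClosed.closure_eq] at h2
      exact h2
    have hψE : ∀ z : E, ∃ e : E, ψ z = e • 1 := by
      intro z
      obtain ⟨c, hc0, hc⟩ := hspan z
      obtain ⟨e, he⟩ := hHE _ (hψH (c • z) (by rwa [smul_assoc]))
      refine ⟨c⁻¹ • e, ?_⟩
      rw [smul_assoc, ← he, map_smul, smul_smul, inv_mul_cancel₀ hc0, one_smul]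
    choose s hs using hψE
    have hinj : Function.Injective fun e : E => e • (1 : A) :=
      (RingHom.smulOneHom : E →+* A).injective
    -- An embedding in all the `Z n` maps H into H, hence `E` into itself.
    let σ : E →ₐ[K] E :=
      { toFun := s
        map_one' := hinj (by simp [← hs])
        map_zero' := hinj (by simp [← hs])
        map_add' := fun x y => hinj (by simp [← hs, add_smul])
        map_mul' := fun x y => hinj (by
          change s (x * y) • (1 : A) = (s x * s y) • (1 : A)
          rw [← hs, map_mul, hs, hs, smul_one_mul_smul_one])
        commutes' := fun k => hinj (by
          change s (algebraMap K E k) • (1 : A) = algebraMap K E k • (1 : A)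
          rw [← hs, ψ.commutes, algebraMap_smul, Algebra.algebraMap_eq_smul_one]) }
    have hψσ : (ψ : E → A) = fun z => σ z • (1 : A) := funext hs
    change U ∈ nhds (ψ : E → A)
    rw [hψσ]
    filter_upwards [eventually_exists_unit_of_conj hmax σ] with ψ' h u hu
    obtain ⟨w, hw, hwσ⟩ := h u hu
    refine ⟨w, hw, fun h hh => ?_⟩
    obtain ⟨e, rfl⟩ := hHE h hh
    rw [hwσ]
    exact hs e ▸ hψH e hh
  -- Since U is a neighbourhood of every point of the intersection, one of the decreasing compact
  -- sets already lies in U; its radius serves as ε.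
  obtain ⟨n, hn⟩ := exists_subset_nhds_of_isCompact' hZanti.directed_ge hZcompact hZclosed hU
  refine ⟨r n, hr n, fun D hHD hD => Set.Subset.antisymm ?_ ?_⟩
  · rintro _ ⟨u, hu, rfl⟩
    have hmem : (fun z : E => ↑u⁻¹ * z • (1 : A) * u) ∈ Z n := by
      refine ⟨⟨conjInclusion K E u, rfl⟩, Set.mem_iInter.2 fun z => ?_⟩
      exact (le_iSup₂ (f := fun s (_ : s ∈ (D : Set A)) => Metric.infEDist s (H : Set A)) _
        (hu _ z.2)).trans hD
    obtain ⟨w, hw, hwH⟩ := hn hmem u fun z => rfl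
    exact ⟨w, hwH, Units.ext hw.symm⟩
  · rintro _ ⟨u, hu, rfl⟩
    exact ⟨u, fun h hh => hHD (hu h hh), rfl⟩

end Main

theorem mainTheorem4
    {K : Type*} [Field K] [ValuativeRel K] [TopologicalSpace K] [IsNonarchimedeanLocalField K]
    {A : Type*} [Ring A] [Algebra K A] [Algebra.IsCentral K A] [IsSimpleRing A]
    [FiniteDimensional K A]
    [MetricSpace A] [IsModuleTopology K A]
    (L : Subalgebra K A) (hL : IsMaximalSubfield L)
    (H : Subalgebra 𝒪[K] A) (hH : IsOrderOfMaximalRankIn H L) :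
    ∃ ε : ℝ, 0 < ε ∧ ∀ D : Subalgebra 𝒪[K] A, IsOrder D → H ≤ D →
      oneSidedHausdorffEDist (D : Set A) (H : Set A) ≤ ENNReal.ofReal ε →
      orderNormSet D H = orderNormSet H H := by
  obtain ⟨hH1, hH2⟩ := hH
  let _ : Field L := hL.prop.toField
  have hmax : ActsAsMaximalSubfield K A L := fun S hS hle s hs =>
    ⟨⟨s, hL.le_of_ge hS (fun x hx => by simpa [Subalgebra.smul_def] using hle ⟨x, hx⟩) hs⟩,
      by simp [Subalgebra.smul_def]⟩
  have hHL : ∀ h ∈ H, h ∈ L := fun h hh => by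
    have : h ∈ Submodule.span K (H : Set A) := Submodule.subset_span hh
    rwa [hH2] at this
  have hspan : ∀ e : L, ∃ c : K, c ≠ 0 ∧ c • e • (1 : A) ∈ H := by
    intro e
    have he : (e : A) ∈ Submodule.span K (H : Set A) := hH2 ▸ e.2
    obtain ⟨c, hc0, hc⟩ := exists_smul_mem_of_mem_span H he
    exact ⟨c, hc0, by simpa [Subalgebra.smul_def] using hc⟩
  obtain ⟨ε, hε, h⟩ := exists_orderNormSet_eq hmax H hH1
    (fun h hh => ⟨⟨h, hHL h hh⟩, by simp [Subalgebra.smul_def]⟩) hspan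
  exact ⟨ε, hε, fun D _ => h D⟩
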